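/- **Setting.** Powers $z^{s}$ of a non-zero complex number use the principal branch, $-\pi<\operatorname{Im}\log z\le\pi$. For a positive integer $M$, the $M$-cover of $\mathrm{SL}_2(\mathbb R)$ is the group of pairs $(\gamma,\varepsilon)$ with $\gamma=\begin{pmatrix}a&b\\c&d\end{pmatrix}\in \mathrm{SL}_2(\mathbb R)$ and $\varepsilon\in\mathbb C$, $\varepsilon^M=1$ (the pair stands for $\gamma$ together with the function $\tau\mapsto\varepsilon\,(c\tau+d)^{1/M}$), with composition $$(\gamma_1,\varepsilon_1)(\gamma_2,\varepsilon_2)=(\gamma_1\gamma_2,\varepsilon_1\varepsilon_2\delta),\qquad \delta=\frac{(c_1\gamma_2\tau+d_1)^{1/M}(c_2\tau+d_2)^{1/M}}{(c_3\tau+d_3)^{1/M}},$$ where $(c_i,d_i)$ is the bottom row of $\gamma_i$ and $(c_3,d_3)$ that of $\gamma_1\gamma_2$; $\delta$ is an $M$-th root of unity that does not depend on $\tau$ in the upper half-plane $\mathbb H$. For a subgroup $G\le\mathrm{SL}_2(\mathbb Z)$, let $\widetilde{G^{M}}$ be the preimage of $G$ in the $M$-cover, and put $\widetilde\gamma=(\gamma,1)$.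 For $k\in\frac1M\mathbb Z$ and $f\colon\mathbb H\to\mathbb C$ put $$\bigl(f|_k(\gamma,\varepsilon)\bigr)(\tau)=\varepsilon^{-Mk}(c\tau+d)^{-k}f(\gamma\tau).$$ Let $\eta$ be the Dedekind eta function, and for $r\in\mathbb Q$ let $\eta^r(\tau)=\exp(r\log\eta(\tau))$, where $\log\eta(\tau)=\log\eta(i)+\int_i^\tau\frac{\eta'(z)}{\eta(z)}\,dz$ and $\log\eta(i)$ is the real logarithm of $\eta(i)>0$. **Proposition.** Let $p$ be a prime, $r_1,r_p\in\mathbb Q$, and let $D$ be a positive integer with $Dr_1,Dr_p\in\mathbb Z$. Put $k'=(r_1+r_p)/2$ and $f(\tau)=\eta^{r_1}(\tau)\,\eta^{r_p}(p\tau)$. There is exactly one group character $\chi=\chi_{r_1,r_p}\colon\widetilde{\Gamma_0(p)^{2D}}\to\mathbb C^\times$ with $f|_{k'}\gamma=\chi(\gamma)f$ for all $\gamma\in\widetilde{\Gamma_0(p)^{2D}}$ (the multiplier system of $f$), and, with $T=\begin{pmatrix}1&1\\0&1\end{pmatrix}$, we have $\chi(\widetilde T)=1$ if and only if $r_1+pr_p\in24\mathbb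 Z$. Suppose that this condition holds, and consider the following three statements. 1. For every $\gamma=\begin{pmatrix}a&b\\c&d\end{pmatrix}\in\Gamma_0(p)$ with $c>0$ and $0\le d<c$, we have $\chi(\widetilde\gamma)=1$. 2. For every $\gamma\in\widetilde{\Gamma_0(p)^{2D}}$, we have $\chi(\gamma)=1$. 3. $r_1\in2\mathbb Z$, $r_1+r_p\in4\mathbb Z$ and $pr_1+r_p\in24\mathbb Z$. Then (1) and (2) are equivalent, and (3) implies (2). Moreover, if $3\mid p+1$ or $4\mid p+1$ or $5\mid p+1$, then (2) implies (3). -/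

import Mathlib

open scoped MatrixGroups UpperHalfPlane

namespace EtaCover

/-- The automorphy factor `c τ + d` of a real matrix `(a, b; c, d)`. -/
noncomputable def autFactor (g : SL(2, ℝ)) (τ : ℍ) : ℂ := (g 1 0 : ℂ) * (τ : ℂ) + (g 1 1 : ℂ)

/-- The `D`-th root `(c τ + d) ^ (1 / D)`, principal branch. -/
noncomputable def autRoot (D : ℕ) (g : SL(2, ℝ)) (τ : ℍ) : ℂ :=
  autFactor g τ ^ (1 / (D : ℂ))

/-- The quotient
`(c₁ (g₂ τ) + d₁) ^ (1 / D) * (c₂ τ + d₂) ^ (1 / D) / (c₃ τ + d₃) ^ (1 / D)`,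
where `(c₃, d₃)` is the bottom row of `g₁ g₂`. -/
noncomputable def delta (D : ℕ) (g₁ g₂ : SL(2, ℝ)) (τ : ℍ) : ℂ :=
  autRoot D g₁ (g₂ • τ) * autRoot D g₂ τ / autRoot D (g₁ * g₂) τ

theorem autFactor_eq_denom (g : SL(2, ℝ)) (τ : ℍ) :
    autFactor g τ = UpperHalfPlane.denom (g : GL (Fin 2) ℝ) τ := rfl

theorem autFactor_ne_zero (g : SL(2, ℝ)) (τ : ℍ) : autFactor g τ ≠ 0 :=
  UpperHalfPlane.denom_ne_zero (g : GL (Fin 2) ℝ) τ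

theorem autFactor_mul (g₁ g₂ : SL(2, ℝ)) (τ : ℍ) :
    autFactor (g₁ * g₂) τ = autFactor g₁ (g₂ • τ) * autFactor g₂ τ := by
  have h := UpperHalfPlane.denom_cocycle (g₁ : GL (Fin 2) ℝ) (g₂ : GL (Fin 2) ℝ) τ.im_ne_zero
  rw [autFactor_eq_denom, autFactor_eq_denom, autFactor_eq_denom, map_mul, h]
  congr 2
  rw [UpperHalfPlane.specialLinearGroup_apply]
  rfl

theorem autRoot_ne_zero (D : ℕ) (g : SL(2, ℝ)) (τ : ℍ) : autRoot D g τ ≠ 0 := by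
  simp [autRoot, Complex.cpow_eq_zero_iff, autFactor_ne_zero]

theorem autRoot_pow {D : ℕ} (hD : D ≠ 0) (g : SL(2, ℝ)) (τ : ℍ) :
    autRoot D g τ ^ D = autFactor g τ := by
  rw [autRoot, one_div, Complex.cpow_nat_inv_pow _ hD]

theorem autRoot_one (D : ℕ) (τ : ℍ) : autRoot D 1 τ = 1 := by
  simp [autRoot, autFactor]

theorem continuous_autRoot (D : ℕ) (g : SL(2, ℝ)) : Continuous (autRoot D g) := by
  by_cases hc : g 1 0 = 0
  · have : autRoot D g = fun _ => ((g 1 1 : ℂ)) ^ (1 / (D : ℂ)) := by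
      funext τ
      simp [autRoot, autFactor, hc]
    rw [this]
    exact continuous_const
  · unfold autRoot
    refine Continuous.cpow ?_ continuous_const ?_
    · unfold autFactor
      exact (continuous_const.mul UpperHalfPlane.continuous_coe).add continuous_const
    · intro τ
      refine Complex.mem_slitPlane_iff.2 (Or.inr ?_)
      simp [autFactor, hc, τ.im_ne_zero]

theorem delta_pow (D : ℕ) (g₁ g₂ : SL(2, ℝ)) (τ : ℍ) : delta D g₁ g₂ τ ^ D = 1 := by
  rcases eq_or_ne D 0 with rfl | hD
  · simp
  · rw [delta, div_pow, mul_pow, autRoot_pow hD, autRoot_pow hD, autRoot_pow hD, autFactor_mul]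
    exact div_self (mul_ne_zero (autFactor_ne_zero _ _) (autFactor_ne_zero _ _))

theorem delta_const (D : ℕ) (g₁ g₂ : SL(2, ℝ)) (τ τ' : ℍ) :
    delta D g₁ g₂ τ = delta D g₁ g₂ τ' := by
  rcases eq_or_ne D 0 with rfl | hD
  · simp [delta, autRoot]
  have hcont : Continuous (delta D g₁ g₂) :=
    (((continuous_autRoot D g₁).comp (continuous_const_smul g₂)).mul
      (continuous_autRoot D g₂)).div (continuous_autRoot D (g₁ * g₂))
      (fun τ => autRoot_ne_zero D _ τ)
  have hfin : {z : ℂ | z ^ D = 1}.Finite := by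
    refine (Polynomial.nthRootsFinset D (1 : ℂ)).finite_toSet.subset fun z hz => ?_
    simpa [Polynomial.mem_nthRootsFinset (Nat.pos_of_ne_zero hD)] using hz
  exact isPreconnected_univ.constant_of_mapsTo hfin.isDiscrete hcont.continuousOn
    (fun τ _ => delta_pow D g₁ g₂ τ) (Set.mem_univ τ) (Set.mem_univ τ')

/-- The `D`-cover of `SL(2, ℝ)`: the pair of `mat = (a, b; c, d)` and of a `D`-th root of unity
`root = ε` stands for the pair of `mat` and of the function `τ ↦ ε (c τ + d) ^ (1 / D)`. -/
@[ext]
structure Cover (D : ℕ) where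
  mat : SL(2, ℝ)
  root : rootsOfUnity D ℂ

namespace Cover

variable {D : ℕ}

/-- The constant value of `delta D g₁ g₂`, as a `D`-th root of unity. -/
noncomputable def deltaRoot (D : ℕ) (g₁ g₂ : SL(2, ℝ)) : rootsOfUnity D ℂ :=
  ⟨Units.mk0 (delta D g₁ g₂ UpperHalfPlane.I)
    (div_ne_zero (mul_ne_zero (autRoot_ne_zero _ _ _) (autRoot_ne_zero _ _ _))
      (autRoot_ne_zero _ _ _)),
    (mem_rootsOfUnity' D _).2 (delta_pow D g₁ g₂ UpperHalfPlane.I)⟩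

/-- The value `ε` of the root of unity as a complex number. -/
noncomputable def eps (x : Cover D) : ℂ := ((x.root : ℂˣ) : ℂ)

noncomputable instance : Mul (Cover D) :=
  ⟨fun x y => ⟨x.mat * y.mat, x.root * y.root * deltaRoot D x.mat y.mat⟩⟩

noncomputable instance : One (Cover D) := ⟨⟨1, 1⟩⟩

noncomputable instance : Inv (Cover D) :=
  ⟨fun x => ⟨x.mat⁻¹, (x.root * deltaRoot D x.mat⁻¹ x.mat)⁻¹⟩⟩

theorem mat_mul (x y : Cover D) : (x * y).mat = x.mat * y.mat := rfl

theorem root_mul (x y : Cover D) :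
    (x * y).root = x.root * y.root * deltaRoot D x.mat y.mat := rfl

/-- The composition law, with the root of unity computed at an arbitrary point. -/
theorem eps_mul (x y : Cover D) (τ : ℍ) :
    (x * y).eps = x.eps * y.eps * delta D x.mat y.mat τ := by
  rw [delta_const D x.mat y.mat τ UpperHalfPlane.I]
  rfl

theorem deltaRoot_assoc (g₁ g₂ g₃ : SL(2, ℝ)) :
    deltaRoot D g₁ g₂ * deltaRoot D (g₁ * g₂) g₃ =
      deltaRoot D g₂ g₃ * deltaRoot D g₁ (g₂ * g₃) := by
  apply Subtype.ext
  apply Units.ext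
  change delta D g₁ g₂ UpperHalfPlane.I * delta D (g₁ * g₂) g₃ UpperHalfPlane.I =
    delta D g₂ g₃ UpperHalfPlane.I * delta D g₁ (g₂ * g₃) UpperHalfPlane.I
  rw [delta_const D g₁ g₂ UpperHalfPlane.I (g₃ • UpperHalfPlane.I)]
  simp only [delta, mul_smul, mul_assoc g₁ g₂ g₃]
  have h1 := autRoot_ne_zero D (g₁ * g₂) (g₃ • UpperHalfPlane.I)
  have h2 := autRoot_ne_zero D (g₂ * g₃) UpperHalfPlane.I
  have h3 := autRoot_ne_zero D (g₁ * (g₂ * g₃)) UpperHalfPlane.I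
  field_simp

theorem deltaRoot_one_left (g : SL(2, ℝ)) : deltaRoot D 1 g = 1 := by
  apply Subtype.ext
  apply Units.ext
  change delta D 1 g UpperHalfPlane.I = 1
  simp [delta, autRoot_one, autRoot_ne_zero]

noncomputable instance : Group (Cover D) :=
  Group.ofLeftAxioms
    (fun x y z => by
      refine Cover.ext (mul_assoc _ _ _) ?_
      have h := deltaRoot_assoc (D := D) x.mat y.mat z.mat
      simp only [root_mul, mat_mul]
      calc x.root * y.root * deltaRoot D x.mat y.mat * z.root *
            deltaRoot D (x.mat * y.mat) z.mat
          = x.root * y.root * z.root *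
            (deltaRoot D x.mat y.mat * deltaRoot D (x.mat * y.mat) z.mat) := by
              simp only [mul_assoc, mul_comm, mul_left_comm]
        _ = _ := by rw [h]; simp only [mul_assoc, mul_comm, mul_left_comm])
    (fun x => by
      refine Cover.ext (one_mul _) ?_
      change 1 * x.root * deltaRoot D 1 x.mat = x.root
      rw [deltaRoot_one_left, one_mul, mul_one])
    (fun x => by
      refine Cover.ext (inv_mul_cancel _) ?_
      change (x.root * deltaRoot D x.mat⁻¹ x.mat)⁻¹ * x.root * deltaRoot D x.mat⁻¹ x.mat = 1
      rw [mul_assoc, inv_mul_cancel])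

/-- The natural projection from the `D`-cover to `SL(2, ℝ)`. -/
noncomputable def proj (D : ℕ) : Cover D →* SL(2, ℝ) where
  toFun := Cover.mat
  map_one' := rfl
  map_mul' _ _ := rfl

end Cover

/-- The `D`-cover of a subgroup `G` of `SL(2, ℤ)`: its preimage under the projection. -/
noncomputable def coverOf (G : Subgroup SL(2, ℤ)) (D : ℕ) : Subgroup (Cover D) :=
  (G.map (Matrix.SpecialLinearGroup.map (n := Fin 2) (Int.castRingHom ℝ))).comap (Cover.proj D)

/-- The distinguished lift `(γ, 1)` of `γ ∈ G` to the `D`-cover of `G`. -/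
noncomputable def lift {G : Subgroup SL(2, ℤ)} (D : ℕ) (γ : G) : coverOf G D :=
  ⟨⟨Matrix.SpecialLinearGroup.map (n := Fin 2) (Int.castRingHom ℝ) (γ : SL(2, ℤ)), 1⟩,
    Subgroup.mem_map_of_mem _ γ.2⟩

/-- The slash operator of weight `k` on functions on the upper half-plane,
`(f ∣ₖ (g, ε)) (τ) = ε ^ (-D k) (c τ + d) ^ (-k) f (g τ)`, meant for `D k ∈ ℤ`.
All powers are principal. -/
noncomputable def slash (D : ℕ) (k : ℚ) (f : ℍ → ℂ) (x : Cover D) : ℍ → ℂ := fun τ =>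
  x.eps ^ (-(((D : ℚ) * k : ℚ) : ℂ)) * autFactor x.mat τ ^ (-(k : ℂ)) * f (x.mat • τ)

/-- The character `χ` of the `D`-cover of `G` is the multiplier system of `f` in weight `k`. -/
def IsMultiplierSystem (G : Subgroup SL(2, ℤ)) (D : ℕ) (k : ℚ) (f : ℍ → ℂ)
    (χ : coverOf G D →* ℂˣ) : Prop :=
  ∀ γ : coverOf G D, slash D k f (γ : Cover D) = fun τ => (χ γ : ℂ) * f τ

/-- `log η (z) = log η (i) + ∫_i^z η'(w) / η(w) dw`, the integral being taken along the segment
from `i` to `z`, for `z` in the upper half-plane; `log η (i)` is the real logarithm of the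
positive real number `η (i)`. -/
noncomputable def logEta (z : ℂ) : ℂ :=
  ((Real.log (ModularForm.eta Complex.I).re : ℝ) : ℂ) +
    ∫ t in (0 : ℝ)..1,
      deriv ModularForm.eta (Complex.I + (t : ℂ) * (z - Complex.I)) /
        ModularForm.eta (Complex.I + (t : ℂ) * (z - Complex.I)) * (z - Complex.I)

/-- The rational power `η ^ r = exp (r log η)`. -/
noncomputable def etaPow (r : ℚ) (z : ℂ) : ℂ := Complex.exp ((r : ℂ) * logEta z)

/-- The eta-quotient `η(τ) ^ r₁ η(p τ) ^ rₚ`. -/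
noncomputable def etaQuotient (p : ℕ) (r₁ rₚ : ℚ) (τ : ℍ) : ℂ :=
  etaPow r₁ (τ : ℂ) * etaPow rₚ ((p : ℂ) * (τ : ℂ))

theorem T_mem_Gamma0 (N : ℕ) : ModularGroup.T ∈ CongruenceSubgroup.Gamma0 N := by
  rw [CongruenceSubgroup.Gamma0_mem]
  simp [ModularGroup.T]

end EtaCover

open EtaCover

namespace EtaCover

open Complex ModularForm Matrix.SpecialLinearGroup

/-! ### The logarithm of the eta function -/

/-! The logarithmic derivative of η is a multiple of the quasi-modular form E₂. Integrating the
behaviour of E₂ under `S` and `T` gives, for every g = (a, b; c, d) in SL(2, ℤ), an integer n(g) =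
`etaPhase g` with log η(gτ) = log η(τ) + ½ log(cτ + d) + πi n(g)/12. This n is additive up to 12
times the integer defect of log(cτ + d), which the signs of the lower left entries determine when
these are non-zero.

Conjugation by diag(p, 1) sends γ ∈ Γ₀(p) to γ' = (a, pb; c/p, d) = `scaled γ`, which acts on pτ
with the same factor cτ + d. So χ of the lift (γ, 1) equals exp(πi q(γ)/12) with q(γ) = r₁ n(γ) + rₚ
n(γ') = `quotientPhase`, and triviality of χ on lifts means q(γ) ∈ 24ℤ. Since q(T) = r₁ + p rₚ, the
criterion for T is immediate.

(1) ⇒ (2): right multiplication by powers of T and inversion reach every γ with c ≠ 0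
(`quotientPhase_of_c_ne_zero`). Squaring (-1, 0; p, -1) then makes the weight integral, so that ε no
longer matters (`weight_even_of_phase`), and c = 0 is reached by multiplying by (1, 0; p, 1).

(3) ⇒ (2): modulo 3 and modulo 4, n is a polynomial in the matrix entries, so with r₁ = 2s and rₚ =
2s' the divisibility 12 ∣ s n(γ) + s' n(γ') becomes an identity in ℤ/3 and ℤ/4 (`twelve_dvd_phase`).

(2) ⇒ (3): -1 and (1, 0; p, 1) yield the last two conditions of (3). If p + 1 = ma with m = 3, 4 or
5, the matrix (a, 1; p, m) gives one more relation, which makes r₁ even for m = 3, 4 but only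
integral for m = 5. There the parity comes from n modulo 8, which contains a Jacobi symbol
(`etaPhase_mod_eight`, `even_of_phase_of_int`). -/

theorem hasDerivAt_logEta {z : ℂ} (hz : 0 < z.im) : HasDerivAt logEta (logDeriv eta z) z := by
  have hconv : Convex ℝ {w : ℂ | 0 < w.im} := convex_halfSpace_im_gt 0
  have hopen : IsOpen {w : ℂ | 0 < w.im} := isOpen_lt continuous_const continuous_im
  have hd : DifferentiableOn ℂ eta {w : ℂ | 0 < w.im} := fun w hw =>
    (differentiableAt_eta_of_mem_upperHalfPlaneSet hw).differentiableWithinAt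
  have hdd : DifferentiableOn ℂ (logDeriv eta) {w : ℂ | 0 < w.im} := by
    unfold logDeriv
    exact (hd.deriv hopen).div hd fun w hw => eta_ne_zero hw
  -- Convexity of the half-plane provides a primitive g of the logarithmic derivative; the segment
  -- integral in `logEta` is then g(w) - g(i).
  obtain ⟨g, hg⟩ := hconv.exists_forall_hasDerivWithinAt hdd
  have hg' : ∀ w : ℂ, 0 < w.im → HasDerivAt g (logDeriv eta w) w := fun w hw =>
    (hg w hw).hasDerivAt (hopen.mem_nhds hw)
  have key : ∀ w : ℂ, 0 < w.im →
      logEta w = ((Real.log (ModularForm.eta I).re : ℝ) : ℂ) + (g w - g I) := by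
    intro w hw
    have hmem : ∀ t ∈ Set.uIcc (0 : ℝ) 1, 0 < (I + (t : ℂ) * (w - I)).im := by
      intro t ht
      rw [Set.uIcc_of_le zero_le_one] at ht
      have := hconv.add_smul_sub_mem (x := I) (y := w) (by simp) hw ht
      simpa using this
    unfold logEta
    congr 1
    have hl : ∀ t : ℝ, HasDerivAt (fun t : ℝ => I + (t : ℂ) * (w - I)) (w - I) t := by
      intro t
      simpa using ((Complex.ofRealCLM.hasDerivAt (x := t)).mul_const (w - I)).const_add I
    have := intervalIntegral.integral_eq_sub_of_hasDerivAt
      (f := fun t : ℝ => g (I + (t : ℂ) * (w - I)))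
      (f' := fun t : ℝ => logDeriv eta (I + (t : ℂ) * (w - I)) * (w - I)) (a := 0) (b := 1)
      (fun t ht => (hg' _ (hmem t ht)).comp t (hl t)) ?_
    · simpa [logDeriv] using this
    · apply ContinuousOn.intervalIntegrable
      refine ContinuousOn.mul ?_ continuousOn_const
      exact hdd.continuousOn.comp (by fun_prop) hmem
  refine (((hg' z hz).sub_const (g I)).const_add
    (((Real.log (ModularForm.eta I).re : ℝ) : ℂ))).congr_of_eventuallyEq ?_
  filter_upwards [hopen.mem_nhds hz] with w hw using key w hw

theorem logDeriv_eta_add_one (z : ℍ) : logDeriv eta ((z : ℂ) + 1) = logDeriv eta z := by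
  have h := congrFun (EisensteinSeries.E2_slash_action ModularGroup.T) z
  have h1 := logDeriv_eta_eq_E2 z
  have h2 := logDeriv_eta_eq_E2 (ModularGroup.T • z)
  have h3 : ((ModularGroup.T • z : ℍ) : ℂ) = z + 1 := by
    rw [UpperHalfPlane.modular_T_smul]; simp [add_comm]
  rw [h3] at h2
  rw [h1, h2]
  rw [ModularForm.SL_slash_apply, EisensteinSeries.D2_T] at h
  have h4 : UpperHalfPlane.denom
      (toGL ((map (Int.castRingHom ℝ)) ModularGroup.T)) (z : ℂ) = 1 := by
    simp [UpperHalfPlane.denom, ModularGroup.coe_T]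
  rw [h4, one_zpow, mul_one, smul_zero, sub_zero] at h
  rw [h]

theorem logDeriv_eta_neg_inv (z : ℍ) :
    logDeriv eta (-(z : ℂ)⁻¹) * ((z : ℂ) ^ 2)⁻¹ = logDeriv eta z + 1 / (2 * (z : ℂ)) := by
  have h := congrFun (EisensteinSeries.E2_slash_action ModularGroup.S) z
  have h1 := logDeriv_eta_eq_E2 z
  have h2 := logDeriv_eta_eq_E2 (ModularGroup.S • z)
  have h3 : ((ModularGroup.S • z : ℍ) : ℂ) = -(z : ℂ)⁻¹ := by
    rw [UpperHalfPlane.modular_S_smul]; simp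
  rw [h3] at h2
  rw [h1, h2]
  rw [ModularForm.SL_slash_apply] at h
  simp only [ModularGroup.denom_S, Pi.sub_apply, Pi.smul_apply, EisensteinSeries.D2_S,
    riemannZeta_two] at h
  have hz := UpperHalfPlane.ne_zero z
  have hpi : (Real.pi : ℂ) ≠ 0 := by exact_mod_cast Real.pi_ne_zero
  have h4 : EisensteinSeries.E2 (ModularGroup.S • z) * ((z : ℂ) ^ 2)⁻¹ =
      EisensteinSeries.E2 z + 6 / (Real.pi * I * z) := by
    have : EisensteinSeries.E2 (ModularGroup.S • z) * ((z : ℂ) ^ 2)⁻¹ =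
      EisensteinSeries.E2 (ModularGroup.S • z) * (z : ℂ) ^ (-2 : ℤ) := by
      rw [zpow_neg]; rfl
    rw [this, h]
    simp only [smul_eq_mul]
    field_simp
    linear_combination (-6 : ℂ) * I_sq
  rw [mul_assoc, h4]
  field_simp
  ring

/-- A function with zero derivative on the upper half-plane is constant. -/
theorem eq_of_hasDerivAt_zero {F : ℂ → ℂ} (hF : ∀ z : ℂ, 0 < z.im → HasDerivAt F 0 z)
    (z w : ℍ) : F z = F w := by
  have hconv : Convex ℝ {w : ℂ | 0 < w.im} := convex_halfSpace_im_gt 0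
  have hopen : IsOpen {w : ℂ | 0 < w.im} := isOpen_lt continuous_const continuous_im
  refine hopen.is_const_of_deriv_eq_zero hconv.isPreconnected
    (fun x hx => (hF x hx).differentiableAt.differentiableWithinAt)
    (fun x hx => (hF x hx).deriv) z.2 w.2

theorem logEta_add_one_sub (z w : ℍ) :
    logEta ((z : ℂ) + 1) - logEta z = logEta ((w : ℂ) + 1) - logEta w := by
  refine eq_of_hasDerivAt_zero (F := fun z => logEta (z + 1) - logEta z) (fun z hz => ?_) z w
  have h1 : HasDerivAt (fun z => logEta (z + 1)) (logDeriv eta (z + 1)) z :=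
    HasDerivAt.comp_add_const z 1 (hasDerivAt_logEta (by simpa using hz))
  have := h1.sub (hasDerivAt_logEta hz)
  rwa [logDeriv_eta_add_one ⟨z, hz⟩, sub_self] at this

theorem logEta_neg_inv_sub (z w : ℍ) :
    logEta (-(z : ℂ)⁻¹) - logEta z - 1 / 2 * log z =
      logEta (-(w : ℂ)⁻¹) - logEta w - 1 / 2 * log w := by
  refine eq_of_hasDerivAt_zero
    (F := fun z => logEta (-z⁻¹) - logEta z - 1 / 2 * log z) (fun z hz => ?_) z w
  have hz0 : z ≠ 0 := UpperHalfPlane.ne_zero ⟨z, hz⟩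
  have hi : HasDerivAt (fun z : ℂ => -z⁻¹) ((z ^ 2)⁻¹) z := by
    convert! (hasDerivAt_inv hz0).neg using 1
    simp
  have him : 0 < (-z⁻¹).im := by
    have := UpperHalfPlane.im_inv_neg_coe_pos ⟨z, hz⟩
    rwa [inv_neg] at this
  have h1 : HasDerivAt (fun z => logEta (-z⁻¹)) (logDeriv eta (-z⁻¹) * (z ^ 2)⁻¹) z :=
    HasDerivAt.comp (h₂ := logEta) z (hasDerivAt_logEta him) hi
  have hl := (hasDerivAt_log (UpperHalfPlane.mem_slitPlane ⟨z, hz⟩)).const_mul (1 / 2 : ℂ)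
  have := (h1.sub (hasDerivAt_logEta hz)).sub hl
  rw [logDeriv_eta_neg_inv ⟨z, hz⟩] at this
  convert! this using 1
  simp
  ring

end EtaCover

namespace EtaCover

open Complex ModularForm

/-! ### Sums of principal logarithms -/

theorem log_add_log {z w : ℂ} (hz : z ≠ 0) (hw : w ≠ 0) :
    ∃ m : ℤ, log z + log w = log (z * w) + 2 * Real.pi * I * m := by
  have h : exp (log z + log w) = exp (log (z * w)) := by
    rw [exp_add, exp_log hz, exp_log hw, exp_log (mul_ne_zero hz hw)]
  obtain ⟨m, hm⟩ := exp_eq_exp_iff_exists_int.1 h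
  exact ⟨m, by rw [hm]; ring⟩

theorem arg_bounds_of_im_pos {z : ℂ} (h : 0 < z.im) : 0 < arg z ∧ arg z < Real.pi := by
  refine ⟨lt_of_le_of_ne (arg_nonneg_iff.2 h.le) fun h0 => ?_,
    lt_of_le_of_ne (arg_le_pi z) fun h0 => ?_⟩
  · exact h.ne' (arg_eq_zero_iff.1 h0.symm).2
  · exact h.ne' (arg_eq_pi_iff.1 h0).2

theorem log_add_log_of_im_pos_of_im_neg {z w : ℂ} (hz : 0 < z.im) (hw : w.im < 0) :
    log z + log w = log (z * w) := by
  have hz0 : z ≠ 0 := by rintro rfl; simp at hz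
  have hw0 : w ≠ 0 := by rintro rfl; simp at hw
  refine (log_mul hz0 hw0 ?_).symm
  have h1 := arg_bounds_of_im_pos hz
  have h2 := arg_neg_iff.2 hw
  have h3 := neg_pi_lt_arg w
  constructor <;> linarith

theorem log_add_log_of_im_pos {z w : ℂ} (hz : 0 < z.im) (hw : 0 < w.im) (h : 0 < (z * w).im) :
    log z + log w = log (z * w) := by
  have hz0 : z ≠ 0 := by rintro rfl; simp at hz
  have hw0 : w ≠ 0 := by rintro rfl; simp at hw
  obtain ⟨m, hm⟩ := log_add_log hz0 hw0
  have him := congrArg Complex.im hm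
  simp [log_im] at him
  have h1 := arg_bounds_of_im_pos hz
  have h2 := arg_bounds_of_im_pos hw
  have h3 := arg_bounds_of_im_pos h
  have h4 : m < 1 := by
    have : (m : ℝ) < 1 := by nlinarith [Real.pi_pos]
    exact_mod_cast this
  have h5 : -1 < m := by
    have : (-1 : ℝ) < m := by nlinarith [Real.pi_pos]
    exact_mod_cast this
  obtain rfl : m = 0 := by omega
  simpa using hm

theorem log_add_log_of_im_mul_neg {z w : ℂ} (hz : 0 < z.im) (hw : 0 < w.im)
    (h : (z * w).im < 0) : log z + log w = log (z * w) + 2 * Real.pi * I := by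
  have hz0 : z ≠ 0 := by rintro rfl; simp at hz
  have hw0 : w ≠ 0 := by rintro rfl; simp at hw
  obtain ⟨m, hm⟩ := log_add_log hz0 hw0
  have him := congrArg Complex.im hm
  simp [log_im] at him
  have h1 := arg_bounds_of_im_pos hz
  have h2 := arg_bounds_of_im_pos hw
  have h3 := arg_neg_iff.2 h
  have h3' := neg_pi_lt_arg (z * w)
  have h4 : m < 2 := by
    have : (m : ℝ) < 2 := by nlinarith [Real.pi_pos]
    exact_mod_cast this
  have h5 : 0 < m := by
    have : (0 : ℝ) < m := by nlinarith [Real.pi_pos]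
    exact_mod_cast this
  obtain rfl : m = 1 := by omega
  simpa using hm

/-! ### Automorphy factors of integral matrices -/

/-- The image of an integral matrix in `SL(2, ℝ)`. -/
noncomputable abbrev realMat (g : SL(2, ℤ)) : SL(2, ℝ) :=
  Matrix.SpecialLinearGroup.map (n := Fin 2) (Int.castRingHom ℝ) g

/-- The automorphy factor `c τ + d` of an integral matrix. -/
noncomputable def intFactor (g : SL(2, ℤ)) (τ : ℍ) : ℂ := autFactor (realMat g) τ

theorem intFactor_apply (g : SL(2, ℤ)) (τ : ℍ) :
    intFactor g τ = (g 1 0 : ℂ) * τ + (g 1 1 : ℂ) := by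
  simp [intFactor, autFactor]

theorem intFactor_im (g : SL(2, ℤ)) (τ : ℍ) : (intFactor g τ).im = g 1 0 * τ.im := by
  simp [intFactor_apply]

theorem intFactor_ne_zero (g : SL(2, ℤ)) (τ : ℍ) : intFactor g τ ≠ 0 := autFactor_ne_zero _ _

theorem intFactor_mul (g h : SL(2, ℤ)) (τ : ℍ) :
    intFactor (g * h) τ = intFactor g (h • τ) * intFactor h τ := by
  have := autFactor_mul (realMat g) (realMat h) τ
  rw [← map_mul] at this
  exact this

theorem intFactor_one (τ : ℍ) : intFactor 1 τ = 1 := by simp [intFactor_apply]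

theorem coe_int_smul (g : SL(2, ℤ)) (τ : ℍ) :
    ((g • τ : ℍ) : ℂ) = ((g 0 0 : ℂ) * τ + g 0 1) / intFactor g τ := by
  rw [UpperHalfPlane.coe_specialLinearGroup_apply, intFactor_apply]
  simp

theorem continuous_log_intFactor (g : SL(2, ℤ)) : Continuous fun τ => log (intFactor g τ) := by
  by_cases hc : g 1 0 = 0
  · simp only [intFactor_apply, hc, Int.cast_zero, zero_mul, zero_add]
    exact continuous_const
  · refine Continuous.clog ?_ fun τ => mem_slitPlane_iff.2 (Or.inr ?_)
    · rw [funext (intFactor_apply g)]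
      exact (continuous_const.mul UpperHalfPlane.continuous_coe).add continuous_const
    · rw [intFactor_im]
      exact mul_ne_zero (by exact_mod_cast hc) τ.im_ne_zero

/-- At each point the defect lies in 2πiℤ; it is continuous in τ, and the upper half-plane is
connected, so one integer serves for all τ. -/
theorem exists_log_intFactor_mul (g h : SL(2, ℤ)) : ∃ m : ℤ, ∀ τ : ℍ,
    log (intFactor g (h • τ)) + log (intFactor h τ) =
      log (intFactor (g * h) τ) + 2 * Real.pi * I * m := by
  have hloc : ∀ τ : ℍ, ∃ m : ℤ, log (intFactor g (h • τ)) + log (intFactor h τ) =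
      log (intFactor (g * h) τ) + 2 * Real.pi * I * m := fun τ => by
    rw [intFactor_mul]
    exact log_add_log (intFactor_ne_zero _ _) (intFactor_ne_zero _ _)
  choose m hm using hloc
  have hpi := two_pi_I_ne_zero
  have hm' : ∀ τ, ((m τ : ℝ) : ℂ) = (log (intFactor g (h • τ)) + log (intFactor h τ) -
      log (intFactor (g * h) τ)) / (2 * Real.pi * I) := fun τ => by
    rw [eq_div_iff hpi, hm]
    push_cast
    ring
  have hcont : Continuous fun τ => (m τ : ℝ) := by
    have : Continuous fun τ => (((m τ : ℝ) : ℂ)).re := by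
      simp only [hm']
      exact continuous_re.comp (((((continuous_log_intFactor g).comp
        (continuous_const_smul (realMat h))).add (continuous_log_intFactor h)).sub
        (continuous_log_intFactor (g * h))).div_const _)
    simpa using this
  have hmc : Continuous m := Int.isClosedEmbedding_coe_real.isEmbedding.continuous_iff.2 hcont
  refine ⟨m UpperHalfPlane.I, fun τ => ?_⟩
  rw [hm τ, (PreconnectedSpace.constant inferInstance hmc : m τ = m UpperHalfPlane.I)]

/-! ### The transformation behaviour of the logarithm of eta -/

/-- `log η (g τ) = log η (τ) + log (c τ + d) / 2 + π i n / 12` for all `τ`. -/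
def HasEtaPhase (g : SL(2, ℤ)) (n : ℤ) : Prop :=
  ∀ τ : ℍ, logEta ((g • τ : ℍ) : ℂ) =
    logEta τ + 1 / 2 * log (intFactor g τ) + Real.pi * I / 12 * n

theorem HasEtaPhase.unique {g : SL(2, ℤ)} {n m : ℤ} (hn : HasEtaPhase g n)
    (hm : HasEtaPhase g m) : n = m := by
  have h := (hn UpperHalfPlane.I).symm.trans (hm UpperHalfPlane.I)
  have hpi : (Real.pi * I / 12 : ℂ) ≠ 0 := by simp [Real.pi_ne_zero]
  exact_mod_cast mul_left_cancel₀ hpi (add_left_cancel h)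

theorem hasEtaPhase_one : HasEtaPhase 1 0 := fun τ => by simp [intFactor_one]

theorem HasEtaPhase.mul {g h : SL(2, ℤ)} {n m k : ℤ} (hg : HasEtaPhase g n)
    (hh : HasEtaPhase h m) (hk : ∀ τ : ℍ, log (intFactor g (h • τ)) + log (intFactor h τ) =
      log (intFactor (g * h) τ) + 2 * Real.pi * I * k) :
    HasEtaPhase (g * h) (n + m + 12 * k) := fun τ => by
  rw [mul_smul, hg, hh]
  push_cast
  linear_combination 1 / 2 * hk τ

theorem HasEtaPhase.inv {g : SL(2, ℤ)} {n : ℤ} (hg : HasEtaPhase g n) :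
    ∃ m, HasEtaPhase g⁻¹ m := by
  obtain ⟨k, hk⟩ := exists_log_intFactor_mul g g⁻¹
  refine ⟨-n - 12 * k, fun τ => ?_⟩
  have h1 := hg (g⁻¹ • τ)
  rw [smul_inv_smul] at h1
  have h2 := hk τ
  rw [mul_inv_cancel, intFactor_one, log_one] at h2
  push_cast
  linear_combination -h1 - 1 / 2 * h2

/-! ### Phases of the generators and existence in general -/

theorem coe_S_smul (τ : ℍ) : ((ModularGroup.S • τ : ℍ) : ℂ) = -(τ : ℂ)⁻¹ := by
  rw [UpperHalfPlane.modular_S_smul]; simp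

theorem coe_T_smul (τ : ℍ) : ((ModularGroup.T • τ : ℍ) : ℂ) = τ + 1 := by
  rw [UpperHalfPlane.modular_T_smul]; simp [add_comm]

theorem hasEtaPhase_S : HasEtaPhase ModularGroup.S (-3) := fun τ => by
  -- The constant is read off at the fixed point i of `S`: it is -½ log i = -πi/4, that is -3 units
  -- of πi/12.
  have h := logEta_neg_inv_sub τ UpperHalfPlane.I
  rw [coe_S_smul, intFactor_apply]
  simp only [UpperHalfPlane.coe_I, inv_I, neg_neg, sub_self, log_I] at h
  simp [ModularGroup.S]
  linear_combination h

theorem hasEtaPhase_T : HasEtaPhase ModularGroup.T 1 := fun τ => by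
  have him : (0 : ℝ) < (exp (Real.pi / 3 * I)).im := by
    have : (Real.pi / 3 * I : ℂ) = ((Real.pi / 3 : ℝ) : ℂ) * I := by push_cast; ring
    rw [this, exp_ofReal_mul_I_im]
    exact Real.sin_pos_of_pos_of_lt_pi (by positivity) (by linarith [Real.pi_pos])
  -- ρ is fixed by TS, so the constant for `T` cancels the change of log η under `S` at ρ: it is
  -- πi/4 - ½ · πi/3 = πi/12.
  let ρ : ℍ := ⟨exp (Real.pi / 3 * I), him⟩
  have hfix : ((ModularGroup.T • ModularGroup.S • ρ : ℍ) : ℂ) = ρ := by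
    rw [coe_T_smul, coe_S_smul]
    change -(exp (Real.pi / 3 * I))⁻¹ + 1 = exp (Real.pi / 3 * I)
    have : (Real.pi / 3 * I : ℂ) = ((Real.pi / 3 : ℝ) : ℂ) * I := by push_cast; ring
    rw [this, ← exp_neg, ← neg_mul, ← ofReal_neg, exp_mul_I, exp_mul_I, ← ofReal_cos,
      ← ofReal_sin, ← ofReal_cos, ← ofReal_sin]
    rw [Real.cos_neg, Real.sin_neg, Real.cos_pi_div_three]
    push_cast
    ring
  have hlog : log (intFactor ModularGroup.S ρ) = Real.pi / 3 * I := by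
    rw [intFactor_apply]
    simp only [ModularGroup.S]
    have : (ρ : ℂ) = exp (Real.pi / 3 * I) := rfl
    simp [this]
    apply log_exp
    · simp; linarith [Real.pi_pos]
    · simp; linarith [Real.pi_pos]
  have h1 := logEta_add_one_sub τ (ModularGroup.S • ρ)
  have h2 := hasEtaPhase_S ρ
  rw [← coe_T_smul, ← coe_T_smul, hfix, h2, hlog] at h1
  have h3 : intFactor ModularGroup.T τ = 1 := by simp [intFactor_apply, ModularGroup.coe_T]
  rw [h3]
  push_cast at h1 ⊢
  simp only [log_one]
  linear_combination h1

theorem exists_hasEtaPhase (g : SL(2, ℤ)) : ∃ n, HasEtaPhase g n := by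
  have hg : g ∈ Subgroup.closure {ModularGroup.S, ModularGroup.T} := by
    simp [SpecialLinearGroup.SL2Z_generators]
  induction hg using Subgroup.closure_induction with
  | mem x hx =>
    rcases hx with rfl | rfl
    exacts [⟨_, hasEtaPhase_S⟩, ⟨_, hasEtaPhase_T⟩]
  | one => exact ⟨_, hasEtaPhase_one⟩
  | mul x y _ _ hx hy =>
    obtain ⟨n, hn⟩ := hx
    obtain ⟨m, hm⟩ := hy
    obtain ⟨k, hk⟩ := exists_log_intFactor_mul x y
    exact ⟨_, hn.mul hm hk⟩
  | inv x _ hx =>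
    obtain ⟨n, hn⟩ := hx
    exact hn.inv

/-- The integer `n` with `log η (g τ) = log η (τ) + log (c τ + d) / 2 + π i n / 12`. -/
noncomputable def etaPhase (g : SL(2, ℤ)) : ℤ := (exists_hasEtaPhase g).choose

theorem etaPhase_spec (g : SL(2, ℤ)) : HasEtaPhase g (etaPhase g) :=
  (exists_hasEtaPhase g).choose_spec

theorem HasEtaPhase.eq {g : SL(2, ℤ)} {n : ℤ} (h : HasEtaPhase g n) : etaPhase g = n :=
  (etaPhase_spec g).unique h

theorem etaPhase_one : etaPhase 1 = 0 := hasEtaPhase_one.eq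

theorem etaPhase_S : etaPhase ModularGroup.S = -3 := hasEtaPhase_S.eq

theorem etaPhase_T : etaPhase ModularGroup.T = 1 := hasEtaPhase_T.eq

/-! ### Multiplication law of the phase -/

theorem etaPhase_mul_of_log {g h : SL(2, ℤ)} {k : ℤ} {τ : ℍ}
    (hk : log (intFactor g (h • τ)) + log (intFactor h τ) =
      log (intFactor (g * h) τ) + 2 * Real.pi * I * k) :
    etaPhase (g * h) = etaPhase g + etaPhase h + 12 * k := by
  obtain ⟨m, hm⟩ := exists_log_intFactor_mul g h
  have : m = k := by
    have := (hm τ).symm.trans hk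
    exact_mod_cast mul_left_cancel₀ two_pi_I_ne_zero (add_left_cancel this)
  subst this
  exact ((etaPhase_spec g).mul (etaPhase_spec h) hm).eq

theorem exists_etaPhase_mul (g h : SL(2, ℤ)) :
    ∃ k : ℤ, etaPhase (g * h) = etaPhase g + etaPhase h + 12 * k := by
  obtain ⟨k, hk⟩ := exists_log_intFactor_mul g h
  exact ⟨k, ((etaPhase_spec g).mul (etaPhase_spec h) hk).eq⟩

/-- The sign of c tells in which half-plane cτ + d lies. This bounds the arguments and so fixes the
integer defect of the logarithms here and in the next two lemmas. -/
theorem etaPhase_mul_of_pos {g h : SL(2, ℤ)} (hg : 0 < g 1 0) (hh : 0 < h 1 0)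
    (hgh : 0 < (g * h) 1 0) : etaPhase (g * h) = etaPhase g + etaPhase h := by
  have := etaPhase_mul_of_log (g := g) (h := h) (k := 0) (τ := UpperHalfPlane.I) ?_
  · simpa using this
  have hz : 0 < (intFactor g (h • UpperHalfPlane.I)).im := by
    rw [intFactor_im]; exact mul_pos (by exact_mod_cast hg) (UpperHalfPlane.im_pos _)
  have hw : 0 < (intFactor h UpperHalfPlane.I).im := by
    rw [intFactor_im]; exact mul_pos (by exact_mod_cast hh) (UpperHalfPlane.im_pos _)
  have hzw : 0 < (intFactor (g * h) UpperHalfPlane.I).im := by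
    rw [intFactor_im]; exact mul_pos (by exact_mod_cast hgh) (UpperHalfPlane.im_pos _)
  rw [intFactor_mul] at hzw ⊢
  rw [log_add_log_of_im_pos hz hw hzw, Int.cast_zero, mul_zero, add_zero]

theorem etaPhase_mul_of_pos_of_neg {g h : SL(2, ℤ)} (hg : 0 < g 1 0) (hh : h 1 0 < 0) :
    etaPhase (g * h) = etaPhase g + etaPhase h := by
  have := etaPhase_mul_of_log (g := g) (h := h) (k := 0) (τ := UpperHalfPlane.I) ?_
  · simpa using this
  have hz : 0 < (intFactor g (h • UpperHalfPlane.I)).im := by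
    rw [intFactor_im]; exact mul_pos (by exact_mod_cast hg) (UpperHalfPlane.im_pos _)
  have hw : (intFactor h UpperHalfPlane.I).im < 0 := by
    rw [intFactor_im]
    exact mul_neg_of_neg_of_pos (by exact_mod_cast hh) (UpperHalfPlane.im_pos _)
  rw [intFactor_mul]
  rw [log_add_log_of_im_pos_of_im_neg hz hw, Int.cast_zero, mul_zero, add_zero]

theorem etaPhase_mul_of_mul_neg {g h : SL(2, ℤ)} (hg : 0 < g 1 0) (hh : 0 < h 1 0)
    (hgh : (g * h) 1 0 < 0) : etaPhase (g * h) = etaPhase g + etaPhase h + 12 := by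
  have := etaPhase_mul_of_log (g := g) (h := h) (k := 1) (τ := UpperHalfPlane.I) ?_
  · simpa using this
  have hz : 0 < (intFactor g (h • UpperHalfPlane.I)).im := by
    rw [intFactor_im]; exact mul_pos (by exact_mod_cast hg) (UpperHalfPlane.im_pos _)
  have hw : 0 < (intFactor h UpperHalfPlane.I).im := by
    rw [intFactor_im]; exact mul_pos (by exact_mod_cast hh) (UpperHalfPlane.im_pos _)
  have hzw : (intFactor (g * h) UpperHalfPlane.I).im < 0 := by
    rw [intFactor_im]
    exact mul_neg_of_neg_of_pos (by exact_mod_cast hgh) (UpperHalfPlane.im_pos _)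
  rw [intFactor_mul] at hzw ⊢
  rw [log_add_log_of_im_mul_neg hz hw hzw, Int.cast_one, mul_one]

theorem etaPhase_inv {g : SL(2, ℤ)} (hg : 0 < g 1 0) : etaPhase g⁻¹ = -etaPhase g := by
  have := etaPhase_mul_of_pos_of_neg (g := g) (h := g⁻¹) hg
    (by simp [Matrix.SpecialLinearGroup.coe_inv, Matrix.adjugate_fin_two, hg])
  rw [mul_inv_cancel, etaPhase_one] at this
  linarith

theorem etaPhase_mul_T (g : SL(2, ℤ)) : etaPhase (g * ModularGroup.T) = etaPhase g + 1 := by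
  have := etaPhase_mul_of_log (g := g) (h := ModularGroup.T) (k := 0) (τ := UpperHalfPlane.I) ?_
  · simpa [etaPhase_T] using this
  have h3 : ∀ τ, intFactor ModularGroup.T τ = 1 := fun τ => by
    simp [intFactor_apply, ModularGroup.coe_T]
  rw [intFactor_mul, h3]
  simp

theorem etaPhase_mul_T_zpow (g : SL(2, ℤ)) (n : ℤ) :
    etaPhase (g * ModularGroup.T ^ n) = etaPhase g + n := by
  induction n using Int.induction_on with
  | zero => simp
  | succ n ih =>
    rw [zpow_add_one, ← mul_assoc, etaPhase_mul_T, ih]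
    ring
  | pred n ih =>
    have := etaPhase_mul_T (g * ModularGroup.T ^ (-(n : ℤ) - 1))
    rw [mul_assoc, ← zpow_add_one, sub_add_cancel, ih] at this
    linarith

end EtaCover

namespace EtaCover

open ModularGroup

/-! ### Values of the phase -/

theorem det_eq (g : SL(2, ℤ)) : g 0 0 * g 1 1 - g 0 1 * g 1 0 = 1 := by
  rw [← Matrix.det_fin_two]; exact g.2

theorem mul_T_zpow_apply (g : SL(2, ℤ)) (n : ℤ) :
    (g * T ^ n) 0 0 = g 0 0 ∧ (g * T ^ n) 0 1 = g 0 0 * n + g 0 1 ∧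
      (g * T ^ n) 1 0 = g 1 0 ∧ (g * T ^ n) 1 1 = g 1 0 * n + g 1 1 := by
  rw [Matrix.SpecialLinearGroup.coe_mul, coe_T_zpow]
  simp [Matrix.mul_apply, Fin.sum_univ_two]

theorem mul_S_apply (g : SL(2, ℤ)) :
    (g * S) 0 0 = g 0 1 ∧ (g * S) 0 1 = -g 0 0 ∧ (g * S) 1 0 = g 1 1 ∧
      (g * S) 1 1 = -g 1 0 := by
  rw [Matrix.SpecialLinearGroup.coe_mul, coe_S]
  simp [Matrix.mul_apply, Fin.sum_univ_two]

theorem coe_S_inv : ((S⁻¹ : SL(2, ℤ)) : Matrix (Fin 2) (Fin 2) ℤ) = !![0, 1; -1, 0] := by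
  simp [Matrix.SpecialLinearGroup.coe_inv, coe_S, Matrix.adjugate_fin_two]

theorem mul_S_inv_apply (g : SL(2, ℤ)) :
    (g * S⁻¹) 0 0 = -g 0 1 ∧ (g * S⁻¹) 0 1 = g 0 0 ∧ (g * S⁻¹) 1 0 = -g 1 1 ∧
      (g * S⁻¹) 1 1 = g 1 0 := by
  rw [Matrix.SpecialLinearGroup.coe_mul, coe_S_inv]
  simp [Matrix.mul_apply, Fin.sum_univ_two]

theorem inv_apply (g : SL(2, ℤ)) :
    g⁻¹ 0 0 = g 1 1 ∧ g⁻¹ 0 1 = -g 0 1 ∧ g⁻¹ 1 0 = -g 1 0 ∧ g⁻¹ 1 1 = g 0 0 := by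
  simp [Matrix.SpecialLinearGroup.coe_inv, Matrix.adjugate_fin_two]

theorem etaPhase_mul_S_inv {g : SL(2, ℤ)} (hc : 0 < g 1 0) :
    etaPhase (g * S⁻¹) = etaPhase g + 3 := by
  rw [etaPhase_mul_of_pos_of_neg hc (by simp), etaPhase_inv (by simp [coe_S]),
    etaPhase_S]
  ring

theorem etaPhase_mul_S {g : SL(2, ℤ)} (hc : 0 < g 1 0) (hd : 0 < g 1 1) :
    etaPhase (g * S) = etaPhase g - 3 := by
  rw [etaPhase_mul_of_pos hc (by simp [coe_S]) (by rw [(mul_S_apply g).2.2.1]; exact hd),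
    etaPhase_S]
  ring

theorem etaPhase_T_zpow (n : ℤ) : etaPhase (T ^ n) = n := by
  simpa [etaPhase_one] using etaPhase_mul_T_zpow 1 n

/-- Such a matrix is T^a S T^d, with phase a - 3 + d. -/
theorem etaPhase_of_c_eq_one {g : SL(2, ℤ)} (hc : g 1 0 = 1) :
    etaPhase g = g 0 0 + g 1 1 - 3 := by
  obtain ⟨h00, h01, h10, h11⟩ := mul_T_zpow_apply g (-g 1 1)
  obtain ⟨k00, k01, k10, k11⟩ := mul_S_inv_apply (g * T ^ (-g 1 1))
  have hdet := det_eq g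
  have h : g * T ^ (-g 1 1) * S⁻¹ = T ^ (g 0 0) := by
    ext i j
    rw [coe_T_zpow]
    fin_cases i <;> fin_cases j <;> simp_all
    linarith
  have h1 := etaPhase_mul_S_inv (g := g * T ^ (-g 1 1)) (by rw [h10, hc]; norm_num)
  rw [h, etaPhase_T_zpow, etaPhase_mul_T_zpow] at h1
  linarith

theorem etaPhase_of_lower {g : SL(2, ℤ)} (hb : g 0 1 = 0) (hc : 0 < g 1 0)
    (hd : g 1 1 = 1) : etaPhase g = -g 1 0 := by
  obtain ⟨k00, k01, k10, k11⟩ := mul_S_inv_apply g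
  obtain ⟨l00, l01, l10, l11⟩ := inv_apply (g * S⁻¹)
  have h10 : (g * S⁻¹)⁻¹ 1 0 = 1 := by rw [l10, k10, hd]; norm_num
  have h1 := etaPhase_of_c_eq_one h10
  have h2 := etaPhase_inv (g := (g * S⁻¹)⁻¹) (by rw [h10]; norm_num)
  rw [inv_inv, etaPhase_mul_S_inv hc, h1, l00, l11, k11, k00, hb] at h2
  linarith

theorem etaPhase_of_b_eq_one {g : SL(2, ℤ)} (hb : g 0 1 = 1) (hc : 0 < g 1 0)
    (hd : 0 < g 1 1) : etaPhase g = 3 - g 1 1 - g 0 0 := by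
  obtain ⟨k00, k01, k10, k11⟩ := mul_S_apply g
  obtain ⟨h00, h01, h10, h11⟩ := mul_T_zpow_apply (g * S) (g 0 0)
  have hdet := det_eq g
  -- As b = 1, the product g S T^a is (1, 0; d, 1).
  have h1 := etaPhase_of_lower (g := g * S * T ^ (g 0 0))
    (by rw [h01, k00, k01, hb]; ring) (by rw [h10, k10]; exact hd)
    (by rw [h11, k10, k11]; rw [hb] at hdet; linarith)
  rw [etaPhase_mul_T_zpow, etaPhase_mul_S hc hd, h10, k10] at h1
  linarith

/-! ### The phase modulo `12` -/

theorem induction_mul_S_T {P : SL(2, ℤ) → Prop} (h1 : P 1) (hS : ∀ g, P (g * S) ↔ P g)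
    (hT : ∀ g, P (g * T) ↔ P g) (g : SL(2, ℤ)) : P g := by
  have hg : g ∈ Subgroup.closure {S, T} := by simp [SpecialLinearGroup.SL2Z_generators]
  induction hg using Subgroup.closure_induction_right with
  | one => exact h1
  | mul_right x _ y hy hx =>
    rcases hy with rfl | rfl
    exacts [(hS x).2 hx, (hT x).2 hx]
  | mul_inv_cancel x _ y hy hx =>
    rcases hy with rfl | rfl
    exacts [(hS _).1 (by simpa using hx), (hT _).1 (by simpa using hx)]

/-- For n ∣ 12 the defect 12k disappears, so the phase modulo n is determined by its value at 1 and
its increments -3 and 1 under right multiplication by `S` and `T`. A candidate φ need only satisfy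
the same recursion, a finite check over `ZMod n`. -/
theorem etaPhase_zmod_eq {n : ℕ} (hn : n ∣ 12) (φ : ZMod n → ZMod n → ZMod n → ZMod n → ZMod n)
    (h1 : φ 1 0 0 1 = 0)
    (hS : ∀ a b c d, a * d - b * c = 1 → φ b (-a) d (-c) = φ a b c d - 3)
    (hT : ∀ a b c d, a * d - b * c = 1 → φ a (a + b) c (c + d) = φ a b c d + 1)
    (g : SL(2, ℤ)) :
    (etaPhase g : ZMod n) = φ (g 0 0) (g 0 1) (g 1 0) (g 1 1) := by
  have h12 : (12 : ZMod n) = 0 := by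
    have := (ZMod.natCast_eq_zero_iff 12 n).2 hn
    exact_mod_cast this
  have hdet : ∀ g : SL(2, ℤ), (g 0 0 : ZMod n) * g 1 1 - g 0 1 * g 1 0 = 1 := fun g => by
    exact_mod_cast congrArg (Int.cast : ℤ → ZMod n) (det_eq g)
  induction g using induction_mul_S_T with
  | h1 => simp [etaPhase_one, h1]
  | hS g =>
    obtain ⟨k, hk⟩ := exists_etaPhase_mul g S
    obtain ⟨k00, k01, k10, k11⟩ := mul_S_apply g
    have h := hS _ _ _ _ (hdet g)
    rw [hk, k00, k01, k10, k11, etaPhase_S]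
    push_cast
    rw [h, h12, zero_mul, add_zero, ← sub_eq_add_neg, sub_left_inj]
  | hT g =>
    obtain ⟨k00, k01, k10, k11⟩ := mul_T_zpow_apply g 1
    rw [zpow_one, mul_one] at *
    have h := hT _ _ _ _ (hdet g)
    rw [etaPhase_mul_T, k00, k01, k10, k11]
    push_cast
    rw [h, add_left_inj]

theorem etaPhase_zmod_three (g : SL(2, ℤ)) : (etaPhase g : ZMod 3) =
    (1 - (g 1 0 : ZMod 3) ^ 2) * (g 0 1 * g 1 1) + g 1 0 * (g 0 0 + g 1 1) :=
  etaPhase_zmod_eq (n := 3) (by norm_num)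
    (fun a b c d => (1 - c ^ 2) * (b * d) + c * (a + d)) (by decide) (by decide) (by decide) g

theorem etaPhase_zmod_four (g : SL(2, ℤ)) : (etaPhase g : ZMod 4) =
    (1 - (g 1 0 : ZMod 4) ^ 2) *
      (g 0 1 * g 1 1 + 3 * (g 1 0 - 1) * g 1 1 + g 1 0 + 3) +
      g 1 0 * (g 0 0 + g 1 1 - 3) :=
  etaPhase_zmod_eq (n := 4) (by norm_num)
    (fun a b c d => (1 - c ^ 2) * (b * d + 3 * (c - 1) * d + c + 3) + c * (a + d - 3))
    (by decide) (by decide) (by decide) g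

/-! ### The phase modulo `8` for odd `c` -/

open NumberTheorySymbols in
theorem jacobiSym_reciprocity_cases {c e : ℕ} (hc : c % 2 = 1) (he : e % 2 = 1)
    (hce : Nat.Coprime c e) : (J(e | c) = 1 ∨ J(e | c) = -1) ∧
      (c % 4 = 3 ∧ e % 4 = 3 ∧ J(c | e) = -J(e | c) ∨
        ¬ (c % 4 = 3 ∧ e % 4 = 3) ∧ J(c | e) = J(e | c)) := by
  refine ⟨jacobiSym.eq_one_or_neg_one (by simpa using hce.symm), ?_⟩
  have hc' := Nat.odd_iff.2 hc
  have he' := Nat.odd_iff.2 he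
  rcases Nat.odd_mod_four_iff.1 hc with h | h
  · exact Or.inr ⟨by omega, jacobiSym.quadratic_reciprocity_one_mod_four h he'⟩
  rcases Nat.odd_mod_four_iff.1 he with h' | h'
  · exact Or.inr ⟨by omega, jacobiSym.quadratic_reciprocity_one_mod_four' hc' h'⟩
  · exact Or.inl ⟨h, h', jacobiSym.quadratic_reciprocity_three_mod_four h h'⟩

open NumberTheorySymbols in
theorem jacobiSym_neg_cases {e : ℕ} (he : e % 2 = 1) (x : ℤ) :
    e % 4 = 1 ∧ J(-x | e) = J(x | e) ∨ e % 4 = 3 ∧ J(-x | e) = -J(x | e) := by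
  rw [jacobiSym.neg x (Nat.odd_iff.2 he)]
  rcases Nat.odd_mod_four_iff.1 he with h | h
  · exact Or.inl ⟨h, by rw [ZMod.χ₄_nat_one_mod_four h, one_mul]⟩
  · exact Or.inr ⟨h, by rw [ZMod.χ₄_nat_three_mod_four h, neg_one_mul]⟩

open NumberTheorySymbols in
-- Quadratic reciprocity in the form needed for one Euclidean step in `etaPhase_mod_eight`, where
-- `S` turns the pair (c, e) into (e, -c).
theorem jacobiSym_reciprocity_neg_left {c e : ℕ} (hc : c % 2 = 1) (he : e % 2 = 1)
    (hce : Nat.Coprime c e) :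
    (8 : ℤ) ∣ -3 * (c + 1) * (e - 1) + 2 * J(e | c) - 2 * J(-c | e) := by
  obtain ⟨hu, hrec⟩ := jacobiSym_reciprocity_cases hc he hce
  have hneg := jacobiSym_neg_cases he c
  generalize J(e | c) = u at *
  generalize J(-c | e) = w at *
  generalize J(c | e) = v at *
  -- For odd c and e, (c + 1)(e - 1) is 4 modulo 8 exactly when c ≡ 1 and e ≡ 3 modulo 4, and 0
  -- otherwise.
  have hprod : (8 : ℤ) ∣ ((c : ℤ) + 1) * (e - 1) - (if c % 4 = 1 ∧ e % 4 = 3 then 4 else 0) := by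
    obtain ⟨i, hi⟩ : ∃ i, c = 4 * i + c % 4 := ⟨c / 4, by omega⟩
    obtain ⟨j, hj⟩ : ∃ j, e = 4 * j + e % 4 := ⟨e / 4, by omega⟩
    have h1 : c % 4 = 1 ∨ c % 4 = 3 := by omega
    have h2 : e % 4 = 1 ∨ e % 4 = 3 := by omega
    rcases h1 with h1 | h1 <;> rcases h2 with h2 | h2 <;> rw [h1] at hi <;> rw [h2] at hj <;>
      simp only [h1, h2] <;> rw [hi, hj] <;> push_cast <;> norm_num <;> ring_nf <;> omega
  rw [mul_assoc]
  generalize ((c : ℤ) + 1) * (e - 1) = P at *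
  split_ifs at hprod <;> omega

open NumberTheorySymbols in
theorem jacobiSym_reciprocity_neg_right {c e : ℕ} (hc : c % 2 = 1) (he : e % 2 = 1)
    (hce : Nat.Coprime c e) :
    (8 : ℤ) ∣ 3 * (c - 1) * (e + 1) - 2 * J(c | e) + 2 * J(-e | c) := by
  have h := jacobiSym_reciprocity_neg_left he hc hce.symm
  have h' : (3 * (c - 1) * (e + 1) - 2 * J(c | e) + 2 * J(-e | c) : ℤ) =
      -(-3 * (e + 1) * (c - 1) + 2 * J(c | e) - 2 * J(-e | c)) := by ring
  rw [h']
  exact h.neg_right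

theorem eight_dvd_sq_sub_one {c : ℤ} (hc : c % 2 = 1) : (8 : ℤ) ∣ c ^ 2 - 1 :=
  Int.eight_dvd_sq_sub_one_of_odd (Int.odd_iff.2 hc)

open NumberTheorySymbols in
/-- The eta multiplier modulo `8`-th roots of unity, for odd positive `c`. -/
theorem etaPhase_mod_eight (c : ℕ) : ∀ g : SL(2, ℤ), g 1 0 = c → c % 2 = 1 →
    (8 : ℤ) ∣ etaPhase g - (c * (g 0 0 + g 1 1 - 3) + 2 - 2 * J(g 1 1 | c)) := by
  induction c using Nat.strong_induction_on with
  | _ c ih =>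
  intro g hgc hc
  rcases eq_or_ne c 1 with rfl | hc1
  · rw [etaPhase_of_c_eq_one (by simpa using hgc)]
    simp
  have hc3 : 1 < c := by omega
  have hc8 : (8 : ℤ) ∣ (c : ℤ) ^ 2 - 1 := eight_dvd_sq_sub_one (by omega)
  -- Euclidean descent: for odd d with |d| < c, multiplication by `S` or `S⁻¹`, according to the
  -- sign of d, makes |d| the new lower left entry. The formulas match by reciprocity, the
  -- determinant, and c² ≡ d² ≡ 1 modulo 8.
  have odd_case : ∀ g : SL(2, ℤ), g 1 0 = c → g 1 1 % 2 = 1 → |g 1 1| < c →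
      (8 : ℤ) ∣ etaPhase g - (c * (g 0 0 + g 1 1 - 3) + 2 - 2 * J(g 1 1 | c)) := by
    intro g hgc hd hlt
    have hdet := det_eq g
    have hcop : IsCoprime (g 1 1) (c : ℤ) := ⟨g 0 0, -g 0 1, by rw [← hgc]; linarith⟩
    rw [hgc] at hdet
    have hd8 := eight_dvd_sq_sub_one hd
    obtain ⟨s, hs⟩ := hd8
    obtain ⟨t, ht⟩ := hc8
    rcases lt_trichotomy (g 1 1) 0 with hneg | h0 | hpos
    · obtain ⟨k00, k01, k10, k11⟩ := mul_S_inv_apply g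
      have hphase := etaPhase_mul_S_inv (g := g) (by omega)
      obtain ⟨e, he⟩ : ∃ e : ℕ, g 1 1 = -e := ⟨(g 1 1).natAbs, by omega⟩
      have hce : Nat.Coprime c e := by
        rw [he, IsCoprime.neg_left_iff, Nat.isCoprime_iff_coprime] at hcop
        exact hcop.symm
      have h := ih e (by rw [he, abs_neg, Nat.abs_cast] at hlt; omega) (g * S⁻¹)
        (by rw [k10, he, neg_neg]) (by omega)
      rw [k00, k11, hgc, hphase] at h
      have hrec := jacobiSym_reciprocity_neg_right hc (by omega : e % 2 = 1) hce
      rw [he] at hdet hs ⊢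
      obtain ⟨x, hx⟩ := h
      obtain ⟨y, hy⟩ := hrec
      refine ⟨x + y + (g 0 1 * e * t + s * g 0 0 * c), ?_⟩
      linear_combination hx + hy + c * e * hdet + g 0 1 * e * ht + g 0 0 * c * hs
    · rw [h0] at hd
      norm_num at hd
    · obtain ⟨k00, k01, k10, k11⟩ := mul_S_apply g
      have hphase := etaPhase_mul_S (g := g) (by omega) hpos
      obtain ⟨e, he⟩ : ∃ e : ℕ, g 1 1 = e := ⟨(g 1 1).natAbs, by omega⟩
      have hce : Nat.Coprime c e := by
        rw [he, Nat.isCoprime_iff_coprime] at hcop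
        exact hcop.symm
      have h := ih e (by rw [he, Nat.abs_cast] at hlt; omega) (g * S)
        (by rw [k10, he]) (by omega)
      rw [k00, k11, hgc, hphase] at h
      have hrec := jacobiSym_reciprocity_neg_left hc (by omega : e % 2 = 1) hce
      rw [he] at hdet hs ⊢
      obtain ⟨x, hx⟩ := h
      obtain ⟨y, hy⟩ := hrec
      refine ⟨x + y + (s * g 0 0 * c - g 0 1 * e * t), ?_⟩
      linear_combination hx + hy - c * e * hdet - g 0 1 * e * ht + g 0 0 * c * hs
  -- As c is odd, one of the two residues d mod c and (d mod c) - c is odd. Translation by T^n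
  -- respects the formula because c² n ≡ n modulo 8.
  obtain ⟨n, hn2, hnlt⟩ : ∃ n : ℤ, (c * n + g 1 1) % 2 = 1 ∧ |c * n + g 1 1| < c := by
    have hc0 : (0 : ℤ) < c := by omega
    have hlt := Int.emod_lt_of_pos (g 1 1) hc0
    have hnn := Int.emod_nonneg (g 1 1) hc0.ne'
    have hdiv := Int.mul_ediv_add_emod (g 1 1) c
    rcases Int.emod_two_eq_zero_or_one (g 1 1 % c) with hpar | hpar
    · have hne : g 1 1 % c ≠ 0 := fun h0 => by
        have h1 : (c : ℤ) ∣ 1 := by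
          rw [← det_eq g, hgc]
          exact dvd_sub (Dvd.dvd.mul_left (Int.dvd_of_emod_eq_zero h0) _) (Dvd.intro_left _ rfl)
        have := Int.le_of_dvd one_pos h1
        omega
      have heq : c * (-(g 1 1 / c) - 1) + g 1 1 = g 1 1 % c - c := by linear_combination -hdiv
      refine ⟨-(g 1 1 / c) - 1, ?_, ?_⟩ <;> rw [heq]
      · omega
      · rw [abs_lt]; omega
    · have heq : c * (-(g 1 1 / c)) + g 1 1 = g 1 1 % c := by linear_combination -hdiv
      refine ⟨-(g 1 1 / c), ?_, ?_⟩ <;> rw [heq]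
      · exact hpar
      · rw [abs_lt]; omega
  obtain ⟨h00, h01, h10, h11⟩ := mul_T_zpow_apply g n
  have h := odd_case (g * T ^ n) (by rw [h10, hgc]) (by rw [h11, hgc]; exact hn2)
    (by rw [h11, hgc]; exact hnlt)
  rw [etaPhase_mul_T_zpow, h00, h11, hgc,
    jacobiSym.mod_left' (a₂ := g 1 1) (by simp)] at h
  obtain ⟨x, hx⟩ := h
  obtain ⟨t, ht⟩ := hc8
  exact ⟨x + t * n, by linear_combination hx + n * ht⟩

end EtaCover

namespace EtaCover

open Complex CongruenceSubgroup

/-! ### Conjugation of `Γ₀(p)` by `diag(p, 1)` -/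

theorem dvd_of_mem_Gamma0 {p : ℕ} (γ : Gamma0 p) : (p : ℤ) ∣ (γ : SL(2, ℤ)) 1 0 :=
  (ZMod.intCast_zmod_eq_zero_iff_dvd _ _).1 (Gamma0_mem.1 γ.2)

theorem mem_Gamma0_of_dvd {p : ℕ} {g : SL(2, ℤ)} (h : (p : ℤ) ∣ g 1 0) : g ∈ Gamma0 p :=
  Gamma0_mem.2 ((ZMod.intCast_zmod_eq_zero_iff_dvd _ _).2 h)

/-- The matrix `(a, p b; c / p, d)` attached to `(a, b; c, d) ∈ Γ₀(p)`. -/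
def scaled {p : ℕ} (γ : Gamma0 p) : SL(2, ℤ) :=
  ⟨!![(γ : SL(2, ℤ)) 0 0, p * (γ : SL(2, ℤ)) 0 1; (γ : SL(2, ℤ)) 1 0 / p, (γ : SL(2, ℤ)) 1 1], by
    have h := Int.mul_ediv_cancel' (dvd_of_mem_Gamma0 γ)
    rw [Matrix.det_fin_two_of]
    linear_combination det_eq (γ : SL(2, ℤ)) - (γ : SL(2, ℤ)) 0 1 * h⟩

section scaled

variable {p : ℕ} (γ : Gamma0 p)

theorem scaled_00 : scaled γ 0 0 = (γ : SL(2, ℤ)) 0 0 := rfl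

theorem scaled_01 : scaled γ 0 1 = p * (γ : SL(2, ℤ)) 0 1 := rfl

theorem mul_scaled_10 : p * scaled γ 1 0 = (γ : SL(2, ℤ)) 1 0 :=
  Int.mul_ediv_cancel' (dvd_of_mem_Gamma0 γ)

theorem scaled_11 : scaled γ 1 1 = (γ : SL(2, ℤ)) 1 1 := rfl

theorem scaled_eq (hp : p ≠ 0) {g : SL(2, ℤ)} (h00 : g 0 0 = (γ : SL(2, ℤ)) 0 0)
    (h01 : g 0 1 = p * (γ : SL(2, ℤ)) 0 1) (h10 : p * g 1 0 = (γ : SL(2, ℤ)) 1 0)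
    (h11 : g 1 1 = (γ : SL(2, ℤ)) 1 1) : scaled γ = g := by
  ext i j
  fin_cases i <;> fin_cases j
  · exact h00.symm
  · exact h01.symm
  · exact mul_left_cancel₀ (Nat.cast_ne_zero.2 hp) ((mul_scaled_10 γ).trans h10.symm)
  · exact h11.symm

theorem mul_apply_fin_two (g h : SL(2, ℤ)) (i j : Fin 2) :
    (g * h) i j = g i 0 * h 0 j + g i 1 * h 1 j := by
  rw [Matrix.SpecialLinearGroup.coe_mul, Matrix.mul_apply, Fin.sum_univ_two]

theorem scaled_mul (hp : p ≠ 0) (δ : Gamma0 p) : scaled (γ * δ) = scaled γ * scaled δ := by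
  have h1 := mul_scaled_10 γ
  have h2 := mul_scaled_10 δ
  apply scaled_eq _ hp <;>
    simp only [Subgroup.coe_mul, mul_apply_fin_two, scaled_00, scaled_01, scaled_11]
  · linear_combination (γ : SL(2, ℤ)) 0 1 * h2
  · ring
  · linear_combination (δ : SL(2, ℤ)) 0 0 * h1 + (γ : SL(2, ℤ)) 1 1 * h2
  · linear_combination (δ : SL(2, ℤ)) 0 1 * h1

theorem scaled_one (hp : p ≠ 0) : scaled (1 : Gamma0 p) = 1 :=
  scaled_eq _ hp (by simp) (by simp) (by simp) (by simp)

theorem scaled_inv (hp : p ≠ 0) : scaled γ⁻¹ = (scaled γ)⁻¹ := by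
  rw [eq_inv_iff_mul_eq_one, ← scaled_mul _ hp, inv_mul_cancel, scaled_one hp]

theorem scaled_10_pos (h : 0 < (γ : SL(2, ℤ)) 1 0) : 0 < scaled γ 1 0 := by
  rw [← mul_scaled_10] at h
  exact pos_of_mul_pos_right h (Int.natCast_nonneg p)

theorem scaled_10_neg (h : (γ : SL(2, ℤ)) 1 0 < 0) : scaled γ 1 0 < 0 := by
  rw [← mul_scaled_10] at h
  exact neg_of_mul_neg_right h (Int.natCast_nonneg p)

/-- The point `p τ` of the upper half-plane. -/
def scalePoint (hp : p ≠ 0) (τ : ℍ) : ℍ :=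
  ⟨(p : ℂ) * τ, by
    simpa using mul_pos (Nat.cast_pos.2 (Nat.pos_of_ne_zero hp)) τ.im_pos⟩

theorem intFactor_scaled (hp : p ≠ 0) (τ : ℍ) :
    intFactor (scaled γ) (scalePoint hp τ) = intFactor γ τ := by
  have h := congrArg (Int.cast : ℤ → ℂ) (mul_scaled_10 γ)
  push_cast at h
  rw [intFactor_apply, intFactor_apply, scaled_11, ← h]
  change _ * ((p : ℂ) * (τ : ℂ)) + _ = _
  ring

theorem coe_scaled_smul (hp : p ≠ 0) (τ : ℍ) :
    ((scaled γ • scalePoint hp τ : ℍ) : ℂ) = p * (((γ : SL(2, ℤ)) • τ : ℍ) : ℂ) := by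
  rw [coe_int_smul, coe_int_smul, intFactor_scaled, scaled_00, scaled_01]
  change (_ * ((p : ℂ) * (τ : ℂ)) + _) / _ = _
  push_cast
  ring

end scaled

/-! ### The transformation behaviour of eta-quotients -/

/-- The phase of the eta-quotient, in units of `π / 12`. -/
noncomputable def quotientPhase {p : ℕ} (r₁ rₚ : ℚ) (γ : Gamma0 p) : ℚ :=
  r₁ * etaPhase γ + rₚ * etaPhase (scaled γ)

theorem etaQuotient_ne_zero (p : ℕ) (r₁ rₚ : ℚ) (τ : ℍ) : etaQuotient p r₁ rₚ τ ≠ 0 :=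
  mul_ne_zero (exp_ne_zero _) (exp_ne_zero _)

theorem etaQuotient_smul {p : ℕ} (hp : p ≠ 0) (r₁ rₚ : ℚ) (γ : Gamma0 p) (τ : ℍ) :
    etaQuotient p r₁ rₚ ((γ : SL(2, ℤ)) • τ) =
      exp (((r₁ + rₚ) / 2 : ℚ) * log (intFactor γ τ)) *
        exp (Real.pi * I / 12 * quotientPhase r₁ rₚ γ) * etaQuotient p r₁ rₚ τ := by
  unfold etaQuotient etaPow
  rw [← coe_scaled_smul γ hp, etaPhase_spec, etaPhase_spec, intFactor_scaled, ← exp_add,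
    ← exp_add, ← exp_add, ← exp_add]
  congr 1
  change _ + (rₚ : ℂ) * (logEta ((p : ℂ) * (τ : ℂ)) + _ + _) = _
  unfold quotientPhase
  push_cast
  ring

theorem slash_etaQuotient {p : ℕ} (hp : p ≠ 0) (r₁ rₚ : ℚ) (M : ℕ) (γ : Gamma0 p)
    (x : Cover M) (hx : x.mat = realMat γ) :
    slash M ((r₁ + rₚ) / 2) (etaQuotient p r₁ rₚ) x = fun τ =>
      (x.eps ^ (-(((M : ℚ) * ((r₁ + rₚ) / 2) : ℚ) : ℂ)) *
        exp (Real.pi * I / 12 * quotientPhase r₁ rₚ γ)) * etaQuotient p r₁ rₚ τ := by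
  funext τ
  unfold slash
  rw [hx]
  change _ * intFactor γ τ ^ _ * etaQuotient p r₁ rₚ ((γ : SL(2, ℤ)) • τ) = _
  rw [etaQuotient_smul hp, cpow_def_of_ne_zero (intFactor_ne_zero _ _)]
  have h : exp (log (intFactor γ τ) * -(((r₁ + rₚ) / 2 : ℚ) : ℂ)) *
      exp (((r₁ + rₚ) / 2 : ℚ) * log (intFactor γ τ)) = 1 := by
    rw [← exp_add, ← exp_zero]
    congr 1
    ring
  linear_combination (x.eps ^ (-(((M : ℚ) * ((r₁ + rₚ) / 2) : ℚ) : ℂ)) *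
        exp (Real.pi * I / 12 * quotientPhase r₁ rₚ γ)) * etaQuotient p r₁ rₚ τ * h

/-! ### The slash operator as an action -/

theorem autFactor_cpow_neg {M : ℕ} (hM : M ≠ 0) {k : ℚ} {n : ℤ} (hn : (M : ℚ) * k = n)
    (g : SL(2, ℝ)) (τ : ℍ) : autFactor g τ ^ (-(k : ℂ)) = autRoot M g τ ^ (-n) := by
  have hk : (k : ℂ) = (1 / (M : ℂ)) * n := by
    have hM' : (M : ℂ) ≠ 0 := Nat.cast_ne_zero.2 hM
    have := congrArg (Rat.cast : ℚ → ℂ) hn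
    push_cast at this
    field_simp
    linear_combination this
  rw [autRoot, hk, cpow_def_of_ne_zero (autFactor_ne_zero g τ),
    cpow_def_of_ne_zero (autFactor_ne_zero g τ), ← exp_int_mul]
  congr 1
  push_cast
  ring

theorem slash_apply {M : ℕ} (hM : M ≠ 0) {k : ℚ} {n : ℤ} (hn : (M : ℚ) * k = n)
    (f : ℍ → ℂ) (x : Cover M) (τ : ℍ) :
    slash M k f x τ = (x.eps * autRoot M x.mat τ) ^ (-n) * f (x.mat • τ) := by
  unfold slash
  rw [autFactor_cpow_neg hM hn, hn, mul_zpow, ← cpow_intCast x.eps]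
  push_cast
  rfl

/-- `delta` is exactly the defect of (cτ + d)^(1/M), so ε (cτ + d)^(1/M) is a true cocycle on the
cover, and so are its integral powers. -/
theorem slash_mul {M : ℕ} (hM : M ≠ 0) {k : ℚ} {n : ℤ} (hn : (M : ℚ) * k = n)
    (f : ℍ → ℂ) (x y : Cover M) : slash M k f (x * y) = slash M k (slash M k f x) y := by
  funext τ
  simp only [slash_apply hM hn, Cover.mat_mul, mul_smul, Cover.eps_mul x y τ]
  rw [← mul_assoc, ← mul_zpow]
  congr 2
  have h := autRoot_ne_zero M (x.mat * y.mat) τ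
  unfold delta
  field_simp

theorem slash_const_mul (M : ℕ) (k : ℚ) (c : ℂ) (f : ℍ → ℂ) (x : Cover M) :
    slash M k (fun τ => c * f τ) x = fun τ => c * slash M k f x τ := by
  funext τ
  unfold slash
  ring

theorem exists_Gamma0_mat_eq {p M : ℕ} (x : coverOf (Gamma0 p) M) :
    ∃ γ : Gamma0 p, (x : Cover M).mat = realMat γ := by
  obtain ⟨g, hg, h⟩ := Subgroup.mem_map.1 (Subgroup.mem_comap.1 x.2)
  exact ⟨⟨g, hg⟩, h.symm⟩

theorem Cover.eps_ne_zero {M : ℕ} (x : Cover M) : x.eps ≠ 0 := Units.ne_zero _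

theorem existsUnique_multiplierSystem {p : ℕ} (hp : p ≠ 0) (r₁ rₚ : ℚ) {M : ℕ} (hM : M ≠ 0)
    {n : ℤ} (hn : (M : ℚ) * ((r₁ + rₚ) / 2) = n) :
    ∃! χ : coverOf (Gamma0 p) M →* ℂˣ,
      IsMultiplierSystem (Gamma0 p) M ((r₁ + rₚ) / 2) (etaQuotient p r₁ rₚ) χ := by
  have hex : ∀ x : coverOf (Gamma0 p) M, ∃ u : ℂˣ,
      slash M ((r₁ + rₚ) / 2) (etaQuotient p r₁ rₚ) (x : Cover M) =
        fun τ => (u : ℂ) * etaQuotient p r₁ rₚ τ := fun x => by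
    obtain ⟨γ, hγ⟩ := exists_Gamma0_mat_eq x
    refine ⟨Units.mk0 _ (mul_ne_zero ?_ (exp_ne_zero _)), slash_etaQuotient hp r₁ rₚ M γ _ hγ⟩
    simp [cpow_eq_zero_iff, Cover.eps_ne_zero]
  have hcancel : ∀ u v : ℂˣ, (fun τ => (u : ℂ) * etaQuotient p r₁ rₚ τ) =
      (fun τ => (v : ℂ) * etaQuotient p r₁ rₚ τ) → u = v := fun u v h =>
    Units.ext (mul_right_cancel₀ (etaQuotient_ne_zero p r₁ rₚ UpperHalfPlane.I)
      (congrFun h UpperHalfPlane.I))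
  choose u hu using hex
  refine ⟨MonoidHom.mk' u fun x y => hcancel _ _ ?_, hu, fun χ hχ => ?_⟩
  · rw [← hu, Subgroup.coe_mul, slash_mul hM hn, hu x, slash_const_mul, hu y]
    funext τ
    push_cast
    ring
  · ext1 x
    exact hcancel _ _ ((hχ x).symm.trans (hu x))

theorem IsMultiplierSystem.apply_eq {p : ℕ} (hp : p ≠ 0) {r₁ rₚ : ℚ} {M : ℕ}
    {χ : coverOf (Gamma0 p) M →* ℂˣ}
    (hχ : IsMultiplierSystem (Gamma0 p) M ((r₁ + rₚ) / 2) (etaQuotient p r₁ rₚ) χ)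
    (x : coverOf (Gamma0 p) M) (γ : Gamma0 p) (hx : (x : Cover M).mat = realMat γ) :
    (χ x : ℂ) = (x : Cover M).eps ^ (-(((M : ℚ) * ((r₁ + rₚ) / 2) : ℚ) : ℂ)) *
        exp (Real.pi * I / 12 * quotientPhase r₁ rₚ γ) :=
  mul_right_cancel₀ (etaQuotient_ne_zero p r₁ rₚ UpperHalfPlane.I)
    (congrFun ((hχ x).symm.trans (slash_etaQuotient hp r₁ rₚ M γ x hx)) UpperHalfPlane.I)

theorem exp_phase_eq_one_iff (q : ℚ) :
    exp (Real.pi * I / 12 * q) = 1 ↔ ∃ n : ℤ, q = 24 * n := by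
  rw [exp_eq_one_iff]
  refine exists_congr fun n => ?_
  have hpi : (Real.pi : ℂ) ≠ 0 := ofReal_ne_zero.2 Real.pi_ne_zero
  constructor
  · intro h
    have : (q : ℂ) = ((24 * n : ℚ) : ℂ) := by
      have h2 : (Real.pi * I : ℂ) ≠ 0 := mul_ne_zero hpi I_ne_zero
      apply mul_left_cancel₀ h2
      push_cast
      linear_combination 12 * h
    exact_mod_cast this
  · rintro rfl
    push_cast
    ring

theorem IsMultiplierSystem.lift_eq_one_iff {p : ℕ} (hp : p ≠ 0) {r₁ rₚ : ℚ} {M : ℕ}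
    {χ : coverOf (Gamma0 p) M →* ℂˣ}
    (hχ : IsMultiplierSystem (Gamma0 p) M ((r₁ + rₚ) / 2) (etaQuotient p r₁ rₚ) χ)
    (γ : Gamma0 p) : χ (lift M γ) = 1 ↔ ∃ n : ℤ, quotientPhase r₁ rₚ γ = 24 * n := by
  have h1 : (lift M γ : Cover M).eps = 1 := rfl
  rw [← exp_phase_eq_one_iff, ← Units.val_inj, hχ.apply_eq hp _ γ rfl, h1, one_cpow, one_mul,
    Units.val_one]

theorem IsMultiplierSystem.eq_one_of_phase {p : ℕ} (hp : p ≠ 0) {r₁ rₚ : ℚ} {M : ℕ}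
    {χ : coverOf (Gamma0 p) M →* ℂˣ}
    (hχ : IsMultiplierSystem (Gamma0 p) M ((r₁ + rₚ) / 2) (etaQuotient p r₁ rₚ) χ)
    {m : ℤ} (hm : r₁ + rₚ = 2 * m) {x : coverOf (Gamma0 p) M} {γ : Gamma0 p}
    (hx : (x : Cover M).mat = realMat γ) (h : ∃ n : ℤ, quotientPhase r₁ rₚ γ = 24 * n) :
    χ x = 1 := by
  rw [← Units.val_inj, hχ.apply_eq hp _ γ hx, (exp_phase_eq_one_iff _).2 h, mul_one,
    Units.val_one]
  -- In integral weight m the exponent of ε is a multiple of M, so ε contributes nothing.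
  have h1 : (-(((M : ℚ) * ((r₁ + rₚ) / 2) : ℚ) : ℂ)) = ((M * -m : ℤ) : ℂ) := by
    rw [hm]
    push_cast
    ring
  have h2 : (x : Cover M).eps ^ M = 1 := (mem_rootsOfUnity' M _).1 (x : Cover M).root.2
  rw [h1, cpow_intCast, zpow_mul, zpow_natCast, h2, one_zpow]

end EtaCover

namespace EtaCover

open CongruenceSubgroup ModularGroup

section phases

variable {p : ℕ} {r₁ rₚ : ℚ}

/-! ### Triviality on a system of representatives -/

theorem T_zpow_mem_Gamma0 (N : ℕ) (n : ℤ) : T ^ n ∈ Gamma0 N := zpow_mem (T_mem_Gamma0 N) n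

theorem scaled_T_zpow (hp : p ≠ 0) (n : ℤ) :
    scaled (⟨T ^ n, T_zpow_mem_Gamma0 p n⟩ : Gamma0 p) = T ^ (p * n) := by
  apply scaled_eq _ hp <;> simp [coe_T_zpow]

theorem quotientPhase_mul_T_zpow (hp : p ≠ 0) (γ : Gamma0 p) (n : ℤ) :
    quotientPhase r₁ rₚ (γ * ⟨T ^ n, T_zpow_mem_Gamma0 p n⟩) =
      quotientPhase r₁ rₚ γ + n * (r₁ + p * rₚ) := by
  unfold quotientPhase
  rw [scaled_mul _ hp, scaled_T_zpow hp, Subgroup.coe_mul, etaPhase_mul_T_zpow,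
    etaPhase_mul_T_zpow]
  push_cast
  ring

theorem quotientPhase_T (hp : p ≠ 0) :
    quotientPhase r₁ rₚ (⟨T, T_mem_Gamma0 p⟩ : Gamma0 p) = r₁ + p * rₚ := by
  have h : scaled (⟨T, T_mem_Gamma0 p⟩ : Gamma0 p) = T ^ (p : ℤ) := by
    simpa only [zpow_one, mul_one] using scaled_T_zpow hp 1
  unfold quotientPhase
  rw [h, etaPhase_T_zpow, etaPhase_T]
  push_cast
  ring

theorem quotientPhase_inv (hp : p ≠ 0) {γ : Gamma0 p} (h : 0 < (γ : SL(2, ℤ)) 1 0) :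
    quotientPhase r₁ rₚ γ⁻¹ = -quotientPhase r₁ rₚ γ := by
  unfold quotientPhase
  rw [scaled_inv _ hp, Subgroup.coe_inv, etaPhase_inv h, etaPhase_inv (scaled_10_pos γ h)]
  push_cast
  ring

theorem quotientPhase_of_c_ne_zero (hp : p ≠ 0) {t : ℤ} (hT : r₁ + p * rₚ = 24 * t)
    (h1 : ∀ γ : Gamma0 p, 0 < (γ : SL(2, ℤ)) 1 0 → 0 ≤ (γ : SL(2, ℤ)) 1 1 →
      (γ : SL(2, ℤ)) 1 1 < (γ : SL(2, ℤ)) 1 0 → ∃ n : ℤ, quotientPhase r₁ rₚ γ = 24 * n)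
    (γ : Gamma0 p) (hc : (γ : SL(2, ℤ)) 1 0 ≠ 0) :
    ∃ n : ℤ, quotientPhase r₁ rₚ γ = 24 * n := by
  have hpos : ∀ γ : Gamma0 p, 0 < (γ : SL(2, ℤ)) 1 0 →
      ∃ n : ℤ, quotientPhase r₁ rₚ γ = 24 * n := by
    intro γ hc
    set m : ℤ := -((γ : SL(2, ℤ)) 1 1 / (γ : SL(2, ℤ)) 1 0) with hm
    obtain ⟨-, -, h10, h11⟩ := mul_T_zpow_apply (γ : SL(2, ℤ)) m
    have hd : (γ : SL(2, ℤ)) 1 0 * m + (γ : SL(2, ℤ)) 1 1 =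
        (γ : SL(2, ℤ)) 1 1 % (γ : SL(2, ℤ)) 1 0 := by
      rw [hm]
      linear_combination -Int.mul_ediv_add_emod ((γ : SL(2, ℤ)) 1 1) ((γ : SL(2, ℤ)) 1 0)
    obtain ⟨n, hn⟩ := h1 (γ * ⟨T ^ m, T_zpow_mem_Gamma0 p m⟩)
      (by rw [Subgroup.coe_mul, h10]; exact hc)
      (by rw [Subgroup.coe_mul, h11, hd]; exact Int.emod_nonneg _ hc.ne')
      (by rw [Subgroup.coe_mul, h10, h11, hd]; exact Int.emod_lt_of_pos _ hc)
    rw [quotientPhase_mul_T_zpow hp, hT] at hn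
    refine ⟨n - m * t, ?_⟩
    push_cast
    linear_combination hn
  rcases lt_or_gt_of_ne hc with h | h
  · have hinv : 0 < ((γ⁻¹ : Gamma0 p) : SL(2, ℤ)) 1 0 := by
      rw [Subgroup.coe_inv, (inv_apply (γ : SL(2, ℤ))).2.2.1]
      omega
    obtain ⟨n, hn⟩ := hpos _ hinv
    have := quotientPhase_inv (r₁ := r₁) (rₚ := rₚ) hp hinv
    rw [inv_inv, hn] at this
    exact ⟨-n, by rw [this]; push_cast; ring⟩
  · exact hpos γ h

/-- The matrix `(-1, 0; p, -1)`. -/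
def negLower (p : ℕ) : Gamma0 p :=
  ⟨⟨!![-1, 0; p, -1], by simp [Matrix.det_fin_two_of]⟩, mem_Gamma0_of_dvd (by simp)⟩

/-- The square of g = (-1, 0; p, -1) has lower left entry -2p < 0 while g has p > 0, so both phases
acquire a defect of 12. Hence 12(r₁ + rₚ) = q(g²) - 2q(g) ∈ 24ℤ. -/
theorem weight_even_of_phase (hp : p ≠ 0) (h : ∀ γ : Gamma0 p, (γ : SL(2, ℤ)) 1 0 ≠ 0 →
    ∃ n : ℤ, quotientPhase r₁ rₚ γ = 24 * n) : ∃ m : ℤ, r₁ + rₚ = 2 * m := by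
  have hp' : (0 : ℤ) < p := by omega
  have hc : 0 < (negLower p : SL(2, ℤ)) 1 0 := hp'
  have hsq : ((negLower p * negLower p : Gamma0 p) : SL(2, ℤ)) 1 0 < 0 := by
    rw [Subgroup.coe_mul, mul_apply_fin_two]
    simp only [negLower, Matrix.of_apply, Matrix.cons_val', Matrix.cons_val_zero,
      Matrix.cons_val_one]
    simp
    omega
  obtain ⟨n, hn⟩ := h _ hc.ne'
  obtain ⟨m, hm⟩ := h _ hsq.ne
  have hs := scaled_10_neg _ hsq
  rw [scaled_mul _ hp] at hs
  have e1 := etaPhase_mul_of_mul_neg hc hc hsq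
  have e2 := etaPhase_mul_of_mul_neg (scaled_10_pos _ hc) (scaled_10_pos _ hc) hs
  unfold quotientPhase at hn hm
  rw [scaled_mul _ hp, e2, Subgroup.coe_mul, e1] at hm
  refine ⟨m - 2 * n, ?_⟩
  push_cast at hm ⊢
  linear_combination (1 / 12) * hm - (1 / 6) * hn

/-- The matrix `(1, 0; p, 1)`. -/
def lower (p : ℕ) : Gamma0 p :=
  ⟨⟨!![1, 0; p, 1], by simp [Matrix.det_fin_two_of]⟩, mem_Gamma0_of_dvd (by simp)⟩

theorem IsMultiplierSystem.eq_one_of_c_ne_zero (hp : p ≠ 0) {M : ℕ}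
    {χ : coverOf (Gamma0 p) M →* ℂˣ}
    (hχ : IsMultiplierSystem (Gamma0 p) M ((r₁ + rₚ) / 2) (etaQuotient p r₁ rₚ) χ)
    (h : ∀ γ : Gamma0 p, (γ : SL(2, ℤ)) 1 0 ≠ 0 →
      ∃ n : ℤ, quotientPhase r₁ rₚ γ = 24 * n) (x : coverOf (Gamma0 p) M) : χ x = 1 := by
  obtain ⟨m, hm⟩ := weight_even_of_phase hp h
  have hlow : (lower p : SL(2, ℤ)) 1 0 ≠ 0 := Nat.cast_ne_zero.2 hp
  obtain ⟨γ, hγ⟩ := exists_Gamma0_mat_eq x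
  by_cases hc : (γ : SL(2, ℤ)) 1 0 = 0
  · have h1 : χ (lift M (lower p)) = 1 := hχ.eq_one_of_phase hp hm rfl (h _ hlow)
    have h2 : χ (x * lift M (lower p)) = 1 := by
      refine hχ.eq_one_of_phase hp hm (γ := γ * lower p) ?_ (h _ ?_)
      · rw [Subgroup.coe_mul, Cover.mat_mul, hγ, Subgroup.coe_mul, realMat, realMat, map_mul]
        rfl
      · rw [Subgroup.coe_mul, mul_apply_fin_two, hc, zero_mul, zero_add]
        refine mul_ne_zero (fun hd => ?_) hlow
        have := det_eq (γ : SL(2, ℤ))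
        rw [hc, hd] at this
        norm_num at this
    rwa [map_mul, h1, mul_one] at h2
  · exact hχ.eq_one_of_phase hp hm hγ (h γ hc)

/-! ### Sufficient conditions -/

theorem zmod_three_phase {P s s' a b c' d : ZMod 3} (h1 : s + P * s' = 0)
    (h2 : P * s + s' = 0) :
    s * ((1 - (P * c') ^ 2) * (b * d) + P * c' * (a + d)) +
      s' * ((1 - c' ^ 2) * (P * b * d) + c' * (a + d)) = 0 := by
  linear_combination ((1 - c' ^ 2) * (P * b * d) + c' * (a + d)) * h2 + b * d * (h1 - P * h2)

theorem zmod_four_phase {P s s' a b c' d : ZMod 4} (h1 : s + P * s' = 0)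
    (h2 : P * s + s' = 0) (hdet : a * d - b * (P * c') = 1) :
    s * ((1 - (P * c') ^ 2) * (b * d + 3 * (P * c' - 1) * d + P * c' + 3) +
        P * c' * (a + d - 3)) +
      s' * ((1 - c' ^ 2) * (P * b * d + 3 * (c' - 1) * d + c' + 3) + c' * (a + d - 3)) = 0 := by
  -- If P is even, both s and s' vanish. For P = 1 the two polynomials coincide and cancel; for P =
  -- -1 they add up to 0 by the determinant.
  have hcases : (s = 0 ∧ s' = 0) ∨ (P = 1 ∧ s' = -s) ∨ (P = -1 ∧ s' = s) := by
    have key : ∀ P s s' : ZMod 4, s + P * s' = 0 → P * s + s' = 0 →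
        (s = 0 ∧ s' = 0) ∨ (P = 1 ∧ s' = -s) ∨ (P = -1 ∧ s' = s) := by decide
    exact key P s s' h1 h2
  rcases hcases with ⟨rfl, rfl⟩ | ⟨rfl, rfl⟩ | ⟨rfl, rfl⟩
  · ring
  · ring
  · have key : ∀ a b c d : ZMod 4, a * d - b * (-1 * c) = 1 →
        ((1 - (-1 * c) ^ 2) * (b * d + 3 * (-1 * c - 1) * d + -1 * c + 3) +
        -1 * c * (a + d - 3)) +
        ((1 - c ^ 2) * (-1 * b * d + 3 * (c - 1) * d + c + 3) + c * (a + d - 3)) = 0 := by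
      decide
    rw [← mul_add, key _ _ _ _ hdet, mul_zero]

theorem twelve_dvd_phase (γ : Gamma0 p) {s s' : ℤ} (h1 : (12 : ℤ) ∣ s + p * s')
    (h2 : (12 : ℤ) ∣ p * s + s') :
    (12 : ℤ) ∣ s * etaPhase γ + s' * etaPhase (scaled γ) := by
  have h3 : (3 : ℤ) ∣ s * etaPhase γ + s' * etaPhase (scaled γ) := by
    rw [← Nat.cast_ofNat, ← ZMod.intCast_zmod_eq_zero_iff_dvd]
    push_cast
    have e1 := (ZMod.intCast_zmod_eq_zero_iff_dvd (s + p * s') 3).2 (by omega)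
    have e2 := (ZMod.intCast_zmod_eq_zero_iff_dvd (p * s + s') 3).2 (by omega)
    push_cast at e1 e2
    rw [etaPhase_zmod_three, etaPhase_zmod_three, scaled_00, scaled_01, scaled_11,
      ← mul_scaled_10]
    push_cast
    exact zmod_three_phase e1 e2
  have h4 : (4 : ℤ) ∣ s * etaPhase γ + s' * etaPhase (scaled γ) := by
    rw [← Nat.cast_ofNat, ← ZMod.intCast_zmod_eq_zero_iff_dvd]
    push_cast
    have e1 := (ZMod.intCast_zmod_eq_zero_iff_dvd (s + p * s') 4).2 (by omega)
    have e2 := (ZMod.intCast_zmod_eq_zero_iff_dvd (p * s + s') 4).2 (by omega)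
    have e3 := congrArg (Int.cast : ℤ → ZMod 4) (det_eq (γ : SL(2, ℤ)))
    rw [← mul_scaled_10] at e3
    push_cast at e1 e2 e3
    rw [etaPhase_zmod_four, etaPhase_zmod_four, scaled_00, scaled_01, scaled_11,
      ← mul_scaled_10]
    push_cast
    exact zmod_four_phase e1 e2 e3
  omega

/-- The condition r₁ + rₚ ∈ 4ℤ serves only to make rₚ an even integer; halving the two conditions
modulo 24 leads to `twelve_dvd_phase`. -/
theorem quotientPhase_of_conditions {t a b c : ℤ} (hT : r₁ + p * rₚ = 24 * t)
    (ha : r₁ = 2 * a) (hb : r₁ + rₚ = 4 * b) (hc : p * r₁ + rₚ = 24 * c) (γ : Gamma0 p) :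
    ∃ n : ℤ, quotientPhase r₁ rₚ γ = 24 * n := by
  have hr : rₚ = 2 * ((2 * b - a : ℤ) : ℚ) := by
    push_cast
    linear_combination hb - ha
  obtain ⟨n, hn⟩ := twelve_dvd_phase γ (s := a) (s' := 2 * b - a)
    ⟨t, by
      rw [hr, ha] at hT
      have : (a : ℚ) + p * ((2 * b - a : ℤ) : ℚ) = 12 * t := by linear_combination hT / 2
      exact_mod_cast this⟩
    ⟨c, by
      rw [hr, ha] at hc
      have : (p : ℚ) * a + ((2 * b - a : ℤ) : ℚ) = 12 * c := by linear_combination hc / 2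
      exact_mod_cast this⟩
  refine ⟨n, ?_⟩
  unfold quotientPhase
  have hn' := congrArg (Int.cast : ℤ → ℚ) hn
  push_cast at hn'
  rw [hr, ha]
  push_cast
  linear_combination 2 * hn'

/-! ### Necessary conditions -/

theorem hasEtaPhase_neg_one : HasEtaPhase (-1) (-6) := fun τ => by
  have h : intFactor (-1) τ = -1 := by simp [intFactor_apply]
  have h2 : ((-1 : SL(2, ℤ)) • τ) = τ := by
    ext1
    rw [coe_int_smul, h]
    simp
  rw [h, h2, Complex.log_neg_one]
  push_cast
  ring

theorem neg_one_mem_Gamma0 (N : ℕ) : (-1 : SL(2, ℤ)) ∈ Gamma0 N :=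
  mem_Gamma0_of_dvd (by simp)

theorem quotientPhase_neg_one (hp : p ≠ 0) :
    quotientPhase r₁ rₚ (⟨-1, neg_one_mem_Gamma0 p⟩ : Gamma0 p) = -6 * (r₁ + rₚ) := by
  have h : scaled (⟨-1, neg_one_mem_Gamma0 p⟩ : Gamma0 p) = -1 := by
    apply scaled_eq _ hp <;> simp
  unfold quotientPhase
  rw [h, hasEtaPhase_neg_one.eq]
  push_cast
  ring

theorem scaled_10_eq_one (hp : p ≠ 0) {γ : Gamma0 p} (h : (γ : SL(2, ℤ)) 1 0 = p) :
    scaled γ 1 0 = 1 := by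
  rw [← mul_scaled_10] at h
  exact mul_left_cancel₀ (Nat.cast_ne_zero.2 hp) (h.trans (mul_one (p : ℤ)).symm)

theorem quotientPhase_lower (hp : p ≠ 0) :
    quotientPhase r₁ rₚ (lower p) = -(p * r₁ + rₚ) := by
  have e1 : etaPhase (lower p : SL(2, ℤ)) = -p :=
    etaPhase_of_lower rfl (Int.natCast_pos.2 (Nat.pos_of_ne_zero hp)) rfl
  have e2 : etaPhase (scaled (lower p)) = 1 + 1 - 3 :=
    etaPhase_of_c_eq_one (scaled_10_eq_one hp rfl)
  unfold quotientPhase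
  rw [e1, e2]
  push_cast
  ring

/-- The matrix is (a, 1; p, q). Its upper right entry 1 and the lower left entry 1 of its conjugate
make both phases explicit, and they are opposite. -/
theorem exists_quotientPhase_of_dvd (hp : p ≠ 0) {q a : ℕ} (hq : 0 < q) (ha : p + 1 = q * a) :
    ∃ γ : Gamma0 p, quotientPhase r₁ rₚ γ = (rₚ - r₁) * (a + q - 3) := by
  have hdet : (a : ℤ) * q - 1 * p = 1 := by
    have := congrArg (Nat.cast : ℕ → ℤ) ha
    push_cast at this
    linear_combination -this
  let γ : Gamma0 p := ⟨⟨!![(a : ℤ), 1; p, q], by rw [Matrix.det_fin_two_of]; exact hdet⟩,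
    mem_Gamma0_of_dvd (by simp)⟩
  have e1 : etaPhase (γ : SL(2, ℤ)) = 3 - q - a :=
    etaPhase_of_b_eq_one rfl (Int.natCast_pos.2 (Nat.pos_of_ne_zero hp)) (Int.natCast_pos.2 hq)
  have e2 : etaPhase (scaled γ) = a + q - 3 :=
    etaPhase_of_c_eq_one (scaled_10_eq_one hp rfl)
  refine ⟨γ, ?_⟩
  unfold quotientPhase
  rw [e1, e2]
  push_cast
  ring

open NumberTheorySymbols in
-- With a non-residue d modulo p as lower right entry and c = p, the phase satisfies n(γ) ≡ p n(γ')
-- + 4 modulo 8. Since p x + rₚ ∈ 24ℤ, this leaves 8 ∣ 4x.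
theorem even_of_phase_of_int (hp : p.Prime) {x w : ℤ} (hp2 : p ≠ 2)
    (hw : (p : ℚ) * x + rₚ = 24 * w)
    (h : ∀ γ : Gamma0 p, ∃ n : ℤ, quotientPhase x rₚ γ = 24 * n) : ∃ n : ℤ, x = 2 * n := by
  have : Fact p.Prime := ⟨hp⟩
  obtain ⟨u, hu⟩ := FiniteField.exists_nonsquare (F := ZMod p) (by rwa [ZMod.ringChar_zmod_n])
  obtain ⟨d, rfl⟩ := ZMod.intCast_surjective u
  have hJ : J(d | p) = -1 := ZMod.nonsquare_iff_jacobiSym_eq_neg_one.2 hu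
  have hcop : IsCoprime d (p : ℤ) := by
    rw [isCoprime_comm, (Nat.prime_iff_prime_int.1 hp).coprime_iff_not_dvd,
      ← ZMod.intCast_zmod_eq_zero_iff_dvd]
    intro h0
    exact hu (h0 ▸ IsSquare.zero)
  obtain ⟨a, b, hab⟩ := hcop
  let γ : Gamma0 p := ⟨⟨!![a, -b; p, d], by rw [Matrix.det_fin_two_of]; linear_combination hab⟩,
    mem_Gamma0_of_dvd (by simp)⟩
  obtain ⟨y, hy⟩ := etaPhase_mod_eight p γ rfl (hp.eq_two_or_odd.resolve_left hp2)
  have e2 : etaPhase (scaled γ) = a + d - 3 :=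
    etaPhase_of_c_eq_one (scaled_10_eq_one hp.ne_zero rfl)
  change etaPhase γ - (p * (a + d - 3) + 2 - 2 * J(d | p)) = 8 * y at hy
  rw [hJ, ← e2] at hy
  obtain ⟨z, hz⟩ := h γ
  unfold quotientPhase at hz
  refine ⟨3 * (z - w * etaPhase (scaled γ)) - x * y, ?_⟩
  have hy' := congrArg (Int.cast : ℤ → ℚ) hy
  push_cast at hy'
  have : (x : ℚ) = 2 * (3 * (z - w * etaPhase (scaled γ)) - x * y : ℤ) := by
    push_cast
    linear_combination (1 / 4) * hz - (1 / 4) * x * hy' - (1 / 4) * etaPhase (scaled γ) * hw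
  exact_mod_cast this

theorem conditions_of_quotientPhase (hp : p.Prime) {t : ℤ} (hT : r₁ + p * rₚ = 24 * t)
    (hdiv : 3 ∣ p + 1 ∨ 4 ∣ p + 1 ∨ 5 ∣ p + 1)
    (h : ∀ γ : Gamma0 p, ∃ n : ℤ, quotientPhase r₁ rₚ γ = 24 * n) :
    (∃ n : ℤ, r₁ = 2 * n) ∧ (∃ n : ℤ, r₁ + rₚ = 4 * n) ∧ (∃ n : ℤ, p * r₁ + rₚ = 24 * n) := by
  obtain ⟨u, hu⟩ := h ⟨-1, neg_one_mem_Gamma0 p⟩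
  rw [quotientPhase_neg_one hp.ne_zero] at hu
  obtain ⟨w, hw⟩ := h (lower p)
  rw [quotientPhase_lower hp.ne_zero] at hw
  refine ⟨?_, ⟨-u, by push_cast; linear_combination (-1 / 6) * hu⟩,
    ⟨-w, by push_cast; linear_combination -hw⟩⟩
  rcases hdiv with ⟨a, ha⟩ | ⟨a, ha⟩ | ⟨a, ha⟩
  all_goals
    obtain ⟨γ, hγ⟩ := exists_quotientPhase_of_dvd (r₁ := r₁) (rₚ := rₚ) hp.ne_zero
      (by norm_num) ha
    obtain ⟨z, hz⟩ := h γ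
    rw [hγ] at hz
    have hpa := congrArg (Nat.cast : ℕ → ℚ) ha
    push_cast at hpa hz
  -- After elimination of rₚ and p, the multipliers of `hz`, `hT` and `hu` are chosen so that the a²
  -- and a terms in the coefficient of r₁ cancel and 1 remains. Times 24 they are -18, 6, -2, all
  -- even. The next case has -8, 2, -2; the last has -5, 1, -2, which gives integrality only.
  · obtain rfl : rₚ = -24 * w - p * r₁ := by linear_combination -hw
    obtain hpa' : (p : ℚ) = 3 * a - 1 := by linear_combination hpa
    rw [hpa'] at hT hu hz
    refine ⟨3 * (3 * (-a * w - z) - (-(3 * a - 1) * w - t)) - (-6 * w + u), ?_⟩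
    push_cast
    linear_combination (-3 / 4) * hz + (1 / 4) * hT - (1 / 12) * hu
  · obtain rfl : rₚ = -24 * w - p * r₁ := by linear_combination -hw
    obtain hpa' : (p : ℚ) = 4 * a - 1 := by linear_combination hpa
    rw [hpa'] at hT hu hz
    refine ⟨4 * (-(a + 1) * w - z) - (-(4 * a - 1) * w - t) - (-6 * w + u), ?_⟩
    push_cast
    linear_combination (-1 / 3) * hz + (1 / 12) * hT - (1 / 12) * hu
  · have hw' : (p : ℚ) * r₁ + rₚ = 24 * (-w : ℤ) := by push_cast; linear_combination -hw
    have hx : r₁ = (5 * (-(a + 2) * w - z) - (-(5 * a - 1) * w - t) - 2 * (-6 * w + u) : ℤ) := by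
      obtain rfl : rₚ = -24 * w - p * r₁ := by linear_combination -hw
      obtain hpa' : (p : ℚ) = 5 * a - 1 := by linear_combination hpa
      rw [hpa'] at hT hu hz
      push_cast
      linear_combination (-5 / 24) * hz + (1 / 24) * hT - (1 / 12) * hu
    obtain ⟨x, rfl⟩ : ∃ x : ℤ, r₁ = x := ⟨_, hx⟩
    have hp2 : p ≠ 2 := by omega
    obtain ⟨n, hn⟩ := even_of_phase_of_int hp hp2 hw' h
    exact ⟨n, by exact_mod_cast hn⟩

end phases

end EtaCover

/-! ### Proof of the proposition -/

open EtaCover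
theorem proposition8p2 (p : ℕ) (hp : p.Prime) (r₁ rₚ : ℚ) (D : ℕ) (hD : 0 < D)
    (hDr₁ : ∃ m : ℤ, (D : ℚ) * r₁ = m) (hDrₚ : ∃ m : ℤ, (D : ℚ) * rₚ = m) :
    (∃! χ : coverOf (CongruenceSubgroup.Gamma0 p) (2 * D) →* ℂˣ,
      IsMultiplierSystem (CongruenceSubgroup.Gamma0 p) (2 * D) ((r₁ + rₚ) / 2)
        (etaQuotient p r₁ rₚ) χ) ∧
    ∀ χ : coverOf (CongruenceSubgroup.Gamma0 p) (2 * D) →* ℂˣ,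
      IsMultiplierSystem (CongruenceSubgroup.Gamma0 p) (2 * D) ((r₁ + rₚ) / 2)
        (etaQuotient p r₁ rₚ) χ →
      (χ (lift (2 * D) ⟨ModularGroup.T, T_mem_Gamma0 p⟩) = 1 ↔
        ∃ n : ℤ, r₁ + p * rₚ = 24 * n) ∧
      ((∃ n : ℤ, r₁ + p * rₚ = 24 * n) →
        -- (1) if and only if (2)
        ((∀ γ : CongruenceSubgroup.Gamma0 p,
            0 < (γ : SL(2, ℤ)) 1 0 → 0 ≤ (γ : SL(2, ℤ)) 1 1 →
            (γ : SL(2, ℤ)) 1 1 < (γ : SL(2, ℤ)) 1 0 → χ (lift (2 * D) γ) = 1) ↔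
          (∀ γ : coverOf (CongruenceSubgroup.Gamma0 p) (2 * D), χ γ = 1)) ∧
        -- (3) implies (2)
        (((∃ n : ℤ, r₁ = 2 * n) ∧ (∃ n : ℤ, r₁ + rₚ = 4 * n) ∧
            (∃ n : ℤ, p * r₁ + rₚ = 24 * n)) →
          ∀ γ : coverOf (CongruenceSubgroup.Gamma0 p) (2 * D), χ γ = 1) ∧
        -- (2) implies (3) under the divisibility assumption
        ((3 ∣ p + 1 ∨ 4 ∣ p + 1 ∨ 5 ∣ p + 1) →
          (∀ γ : coverOf (CongruenceSubgroup.Gamma0 p) (2 * D), χ γ = 1) →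
          (∃ n : ℤ, r₁ = 2 * n) ∧ (∃ n : ℤ, r₁ + rₚ = 4 * n) ∧
            (∃ n : ℤ, p * r₁ + rₚ = 24 * n))) := by
  have hp0 := hp.ne_zero
  obtain ⟨m₁, hm₁⟩ := hDr₁
  obtain ⟨m₂, hm₂⟩ := hDrₚ
  refine ⟨existsUnique_multiplierSystem hp0 r₁ rₚ (n := m₁ + m₂) (by omega)
    (by push_cast; linear_combination hm₁ + hm₂), fun χ hχ => ⟨?_, ?_⟩⟩
  · rw [hχ.lift_eq_one_iff hp0, quotientPhase_T hp0]
  rintro ⟨t, ht⟩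
  refine ⟨⟨fun h1 => ?_, fun h2 γ _ _ _ => h2 _⟩, ?_, fun hdiv h2 => ?_⟩
  · exact hχ.eq_one_of_c_ne_zero hp0 (quotientPhase_of_c_ne_zero hp0 ht
      fun γ hc hd hdc => (hχ.lift_eq_one_iff hp0 γ).1 (h1 γ hc hd hdc))
  · rintro ⟨⟨a, ha⟩, ⟨b, hb⟩, ⟨c, hc⟩⟩
    exact hχ.eq_one_of_c_ne_zero hp0 fun γ _ => quotientPhase_of_conditions ht ha hb hc γ
  · exact conditions_of_quotientPhase hp ht hdiv fun γ => (hχ.lift_eq_one_iff hp0 γ).1 (h2 _)
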